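/- **Definitions.** An *electrical network* on a countable set $V$ is a connected simple graph on $V$ with symmetric conductances $c(x,y)\ge 0$, positive exactly on edges, with $\sum_y c(x,y)<\infty$ for all $x$. Put $\mathcal E(f,g)=\frac12\sum_{x,y}c(x,y)(f(x)-f(y))(g(x)-g(y))$ and $\mathcal F=\{f:\mathcal E(f,f)<\infty\}$; this is a resistance form. The *resistance metric* of a resistance form $(\mathcal E,\mathcal F)$ is $R(x,y)=\sup\{|f(x)-f(y)|^2/\mathcal E(f,f): f\in\mathcal F,\ \mathcal E(f,f)>0\}$, and $R(A,B)=\big(\inf\{\mathcal E(f,f): f\in\mathcal F,\ f|_A=1,\ f|_B=0\}\big)^{-1}$ for sets $A,B$ (equal to $0$ if there is no such $f$). The form, and its metric $R$ (which determines the form), are *recurrent* if $\lim_{r\to\infty}R(\rho,B_R(\rho,r)^c)=\infty$, where $B_R(\rho,r)$ is the open ball. A metric space is *boundedly compact* if its closed balls are compact. For a recurrent network with boundedly compact resistance metric and $\emptyset\ne B\subseteq V$, the *trace* onto $B$ has conductances $c|_B(x,y)=-\mathcal E(h_x,h_y)$ for $x\neq y$ in $B$ and $c|_B(x,x)=0$,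 where $h_x$ is the function of minimal energy among those equal to $1_{\{x\}}$ on $B$. The *local Gromov–Hausdorff topology* on rooted boundedly compact metric spaces is induced by the metric given by the infimum of $\int_0^\infty e^{-r}\big(1\wedge d_H(\overline{f_1(S_1)\cap B(o,r)},\overline{f_2(S_2)\cap B(o,r)})\big)\,dr$ over all rooted boundedly compact metric spaces $(M,o)$ and all root- and distance-preserving maps $f_i:S_i\to M$, where $d_H$ is the Hausdorff metric. **Setting.** Let $W$ be a set, $\rho\in W$, and let $(V_n)_{n\ge1}$, $(K^{(N)})_{N\ge1}$ be increasing sequences of subsets of $W$ that all contain $\rho$, with each $V_n$ countable, $V:=\bigcup_n V_n\subseteq\bigcup_N K^{(N)}$, and $V_n^{(N)}:=V_n\cap K^{(N)}$ finite for all $n,N$; put $V^{(N)}:=V\cap K^{(N)}$. Let $G_n$ be an electrical network on $V_n$ whose resistance metric $R_n$ is recurrent and such that $(V_n,R_n)$ is boundedly compact; put $\rho_n:=\rho$. Let $G|_n$ be electrical networks on $V_n$ with conductances $c|_n$ and resistance metrics $R|_n$ that are compatible: $R|_m=R|_n$ on $V_m\times V_m$ for $m\le n$. Let $R$ be the metric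 on $V$ that equals $R|_m$ on each $V_m$, and let $(F,R)$ be the completion of $(V,R)$. For $n\ge m$ let $c_n|_m$ be the conductances of the trace of $G_n$ onto $V_m$. The fused conductances $c_n|_m^{(N)}$ on $V_m^{(N)}\cup\{V_m\setminus K^{(N)}\}$ are $c_n|_m^{(N)}(x,y)=c_n|_m(x,y)$ and $c_n|_m^{(N)}(x,V_m\setminus K^{(N)})=\sum_{y\in V_m\setminus K^{(N)}}c_n|_m(x,y)$ for $x,y\in V_m^{(N)}$; define $c|_m^{(N)}$ from $c|_m$ in the same way. **Assumption A.** (i) For each $m$ there is a map $g_m:V\to V_m$ with $g_m(V^{(N)})\subseteq V_m^{(N)}$ and $g_m(V\setminus K^{(N)})\subseteq V_m\setminus K^{(N)}$ for all $N$, such that $\lim_{m\to\infty}\limsup_{n\to\infty}\sup_{x\in V_n}R_n(x,g_m(x))=0$ and $\lim_{m\to\infty}\sup_{x\in V}R(x,g_m(x))=0$. (ii) $\limsup_{n\to\infty}\sup_{x\in V_m^{(N)}}R_n(\rho_n,x)<\infty$ for all $m,N$. (iii) $\lim_{N\to\infty}\limsup_{n\to\infty}R_n(\rho_n,V_n\setminus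 K^{(N)})=\infty$. (iv) For all $m,N$ and all $x,y\in V_m^{(N)}\cup\{V_m\setminus K^{(N)}\}$, $c_n|_m^{(N)}(x,y)\to c|_m^{(N)}(x,y)$ as $n\to\infty$. **Theorem A.** Under Assumption A, $(F,R)$ is boundedly compact, and $R$ is a recurrent resistance metric on $F$. Moreover $(V_n,R_n,\rho_n)\to(F,R,\rho)$ in the local Gromov–Hausdorff topology, and the non-explosion condition $\lim_{r\to\infty}\liminf_{n\to\infty}R_n(\rho_n,B_{R_n}(\rho_n,r)^c)=\infty$ holds. -/

import Mathlib

open Filter Topology Set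
open scoped ENNReal NNReal

universe u

/-! ### Energies and effective resistance -/

/-- Effective resistance `R(A, B) = (inf {E(f,f) : f = 1 on A, f = 0 on B})⁻¹` between two sets,
for an energy `E` (`E f` stands for `E(f,f)`, with the value `∞` outside the domain of the form).
It is `0` if there is no admissible function of finite energy. -/
noncomputable def effRes {X : Type u} (E : (X → ℝ) → ℝ≥0∞) (A B : Set X) : ℝ≥0∞ :=
  (⨅ (f : X → ℝ) (_ : ∀ x ∈ A, f x = 1) (_ : ∀ x ∈ B, f x = 0), E f)⁻¹

/-- `sup {|f(x) - f(y)|² / E(f,f) : 0 < E(f,f) < ∞}`. -/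
noncomputable def resSup {X : Type u} (E : (X → ℝ) → ℝ≥0∞) (x y : X) : ℝ≥0∞ :=
  ⨆ (f : X → ℝ) (_ : 0 < E f) (_ : E f < ⊤), ENNReal.ofReal (|f x - f y| ^ 2) / E f

/-- Recurrence of an energy `E` with resistance metric `d`:
`R(x, B_d(x, r)ᶜ) → ∞` as `r → ∞`, where `B_d(x, r)` is the open ball. -/
def IsRecurrentAt {X : Type u} (E : (X → ℝ) → ℝ≥0∞) (d : X → X → ℝ) (x : X) : Prop :=
  Tendsto (fun r : ℝ => effRes E {x} {y | d x y < r}ᶜ) atTop (𝓝 ⊤)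

/-! ### Resistance forms -/

open Classical in
/-- The energy `f ↦ B(f,f)` of a bilinear form with domain `D`, equal to `∞` outside `D`. -/
noncomputable def formEnergy {X : Type u} (D : Submodule ℝ (X → ℝ)) (B : D →ₗ[ℝ] D →ₗ[ℝ] ℝ)
    (f : X → ℝ) : ℝ≥0∞ :=
  if h : f ∈ D then ENNReal.ofReal (B ⟨f, h⟩ ⟨f, h⟩) else ⊤

/-- Resistance forms on a set `X` (in the sense of Kigami). -/
structure ResistanceForm (X : Type u) where
  /-- the domain of the form -/
  domain : Submodule ℝ (X → ℝ)
  /-- the bilinear form -/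
  form : domain →ₗ[ℝ] domain →ₗ[ℝ] ℝ
  const_mem : ∀ a : ℝ, (fun _ => a) ∈ domain
  symm : ∀ f g, form f g = form g f
  nonneg : ∀ f, 0 ≤ form f f
  eq_zero_iff : ∀ f : domain, form f f = 0 ↔ ∃ a : ℝ, ∀ x, f.1 x = a
  /-- the domain modulo constants is complete, hence a Hilbert space -/
  complete : ∀ f : ℕ → domain,
    (∀ ε > 0, ∃ k, ∀ i ≥ k, ∀ j ≥ k, form (f i - f j) (f i - f j) < ε) →
    ∃ g : domain, Tendsto (fun i => form (f i - g) (f i - g)) atTop (𝓝 0)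
  separates : ∀ x y, x ≠ y → ∃ f ∈ domain, f x ≠ f y
  resistance_lt_top : ∀ x y, resSup (formEnergy domain form) x y < ⊤
  markov : ∀ f : domain, ∃ h : (fun x => max (min (f.1 x) 1) 0) ∈ domain,
    form ⟨_, h⟩ ⟨_, h⟩ ≤ form f f

/-- The energy of a resistance form, `∞` outside the domain. -/
noncomputable def ResistanceForm.energy {X : Type u} (𝓔 : ResistanceForm X) :
    (X → ℝ) → ℝ≥0∞ :=
  formEnergy 𝓔.domain 𝓔.form

/-- The resistance metric of a resistance form. -/
noncomputable def ResistanceForm.res {X : Type u} (𝓔 : ResistanceForm X) (x y : X) : ℝ :=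
  (resSup 𝓔.energy x y).toReal

/-- The metric of `X` is a resistance metric and the corresponding resistance form is recurrent
(a resistance form is determined by its resistance metric). -/
def IsRecurrentResistanceMetric (X : Type u) [MetricSpace X] (x : X) : Prop :=
  ∃ 𝓔 : ResistanceForm X, (∀ y z, 𝓔.res y z = dist y z) ∧
    IsRecurrentAt 𝓔.energy (fun y z => dist y z) x

/-! ### Electrical networks -/

/-- Electrical networks with vertex set `V`: a connected simple graph with
conductances that are positive exactly on the edges and locally summable. -/
structure ElectricalNetwork (V : Type u) where
  /-- the graph -/
  graph : SimpleGraph V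
  connected : graph.Connected
  /-- the conductances -/
  cond : V → V → ℝ≥0
  symm : ∀ x y, cond x y = cond y x
  pos_iff : ∀ x y, 0 < cond x y ↔ graph.Adj x y
  summable : ∀ x, Summable (cond x)

namespace ElectricalNetwork

variable {V : Type u} (G : ElectricalNetwork V)

/-- The energy `½ ∑ c(x,y) (f(x) - f(y))²`, possibly infinite. -/
noncomputable def energy (f : V → ℝ) : ℝ≥0∞ :=
  2⁻¹ * ∑' x, ∑' y, (G.cond x y : ℝ≥0∞) * ENNReal.ofReal ((f x - f y) ^ 2)

/-- The bilinear form `½ ∑ c(x,y) (f(x) - f(y)) (g(x) - g(y))`; the sum converges absolutely if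
`f` and `g` have finite energy. -/
noncomputable def form (f g : V → ℝ) : ℝ :=
  2⁻¹ * ∑' p : V × V, (G.cond p.1 p.2 : ℝ) * (f p.1 - f p.2) * (g p.1 - g p.2)

/-- The resistance metric of the network. -/
noncomputable def res (x y : V) : ℝ := (resSup G.energy x y).toReal

open Classical in
/-- The harmonic extension of `φ` from `B`: the function of least energy among those that
agree with `φ` on `B`. -/
noncomputable def harmExt (B : Set V) (φ : V → ℝ) : V → ℝ :=
  Classical.epsilon fun h : V → ℝ =>
    (∀ x ∈ B, h x = φ x) ∧ G.energy h < ⊤ ∧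
      ∀ v : V → ℝ, (∀ x ∈ B, v x = φ x) → G.energy h ≤ G.energy v

open Classical in
/-- The conductances of the trace of the network onto `B`. -/
noncomputable def traceCond (B : Set V) (x y : V) : ℝ :=
  if x = y then 0
  else -G.form (G.harmExt B (Set.indicator {x} 1)) (G.harmExt B (Set.indicator {y} 1))

/-! The resistance of a network is a metric. -/

theorem exists_bound (x y : V) :
    ∃ C : ℝ≥0, ∀ f : V → ℝ, ENNReal.ofReal ((f x - f y) ^ 2) ≤ C * G.energy f := by
  obtain ⟨w⟩ := G.connected.preconnected x y
  induction w with
  | nil => exact ⟨0, fun f => by simp⟩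
  | @cons a b c h p ih =>
    obtain ⟨C, hC⟩ := ih
    have hpos := (G.pos_iff a b).2 h
    refine ⟨2 * (2 * (G.cond a b)⁻¹ + C), fun f => ?_⟩
    have h1 : (G.cond a b : ℝ≥0∞) * ENNReal.ofReal ((f a - f b) ^ 2) ≤ 2 * G.energy f := by
      unfold energy
      rw [← mul_assoc, ENNReal.mul_inv_cancel (by simp) (by simp), one_mul]
      exact (ENNReal.le_tsum (f := fun y => (G.cond a y : ℝ≥0∞) *
        ENNReal.ofReal ((f a - f y) ^ 2)) b).trans
        (ENNReal.le_tsum (f := fun x => ∑' y, (G.cond x y : ℝ≥0∞) *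
          ENNReal.ofReal ((f x - f y) ^ 2)) a)
    have h2 : ENNReal.ofReal ((f a - f b) ^ 2) ≤ 2 * ((G.cond a b)⁻¹ : ℝ≥0) * G.energy f := by
      have hc : ((G.cond a b)⁻¹ : ℝ≥0) * (G.cond a b : ℝ≥0∞) = 1 := by
        rw [← ENNReal.coe_mul, inv_mul_cancel₀ hpos.ne']; simp
      calc ENNReal.ofReal ((f a - f b) ^ 2)
          = ((G.cond a b)⁻¹ : ℝ≥0) * ((G.cond a b : ℝ≥0∞) *
              ENNReal.ofReal ((f a - f b) ^ 2)) := by rw [← mul_assoc, hc, one_mul]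
        _ ≤ ((G.cond a b)⁻¹ : ℝ≥0) * (2 * G.energy f) := by gcongr
        _ = _ := by ring
    have h3 : ENNReal.ofReal ((f a - f c) ^ 2) ≤
        2 * (ENNReal.ofReal ((f a - f b) ^ 2) + ENNReal.ofReal ((f b - f c) ^ 2)) := by
      have e2 : (2 : ℝ≥0∞) = ENNReal.ofReal 2 := by simp
      rw [← ENNReal.ofReal_add (sq_nonneg _) (sq_nonneg _), e2,
        ← ENNReal.ofReal_mul (by norm_num)]
      apply ENNReal.ofReal_le_ofReal
      nlinarith [sq_nonneg ((f a - f b) - (f b - f c))]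
    calc _ ≤ _ := h3
      _ ≤ 2 * (2 * ((G.cond a b)⁻¹ : ℝ≥0) * G.energy f + C * G.energy f) := by
        gcongr
        exact hC f
      _ = _ := by push_cast; ring

theorem resSup_lt_top (x y : V) : resSup G.energy x y < ⊤ := by
  obtain ⟨C, hC⟩ := G.exists_bound x y
  refine lt_of_le_of_lt (b := (C : ℝ≥0∞)) ?_ ENNReal.coe_lt_top
  refine iSup_le fun f => iSup_le fun h0 => iSup_le fun _ => ?_
  rw [sq_abs]
  exact ENNReal.div_le_of_le_mul (hC f)

theorem res_nonneg (x y : V) : 0 ≤ G.res x y := ENNReal.toReal_nonneg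

theorem sq_le_res_mul {f : V → ℝ} (hf : G.energy f < ⊤) (x y : V) :
    (f x - f y) ^ 2 ≤ G.res x y * (G.energy f).toReal := by
  have key : ENNReal.ofReal ((f x - f y) ^ 2) ≤ resSup G.energy x y * G.energy f := by
    rcases eq_or_ne (G.energy f) 0 with h0 | h0
    · obtain ⟨C, hC⟩ := G.exists_bound x y
      have := hC f
      rw [h0, mul_zero] at this
      exact this.trans zero_le
    · rw [← ENNReal.div_le_iff h0 hf.ne, ← sq_abs]
      exact le_iSup_of_le f (le_iSup_of_le (pos_iff_ne_zero.2 h0) (le_iSup_of_le hf le_rfl))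
  rw [res, ← ENNReal.toReal_mul]
  exact (ENNReal.ofReal_le_iff_le_toReal
    (ENNReal.mul_lt_top (G.resSup_lt_top x y) hf).ne).1 key

theorem res_le {x y : V} {r : ℝ} (hr : 0 ≤ r)
    (h : ∀ f : V → ℝ, G.energy f < ⊤ → (f x - f y) ^ 2 ≤ r * (G.energy f).toReal) :
    G.res x y ≤ r := by
  refine ENNReal.toReal_le_of_le_ofReal hr ?_
  refine iSup_le fun f => iSup_le fun h0 => iSup_le fun hf => ?_
  refine ENNReal.div_le_of_le_mul ?_
  rw [sq_abs, ← ENNReal.ofReal_toReal hf.ne, ← ENNReal.ofReal_mul hr]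
  exact ENNReal.ofReal_le_ofReal (h f hf)

theorem res_comm (x y : V) : G.res x y = G.res y x := by
  simp only [res, resSup, abs_sub_comm]

theorem res_self (x : V) : G.res x x = 0 := by
  simp [res, resSup]

theorem energy_indicator_lt_top (x : V) : G.energy (Set.indicator {x} 1) < ⊤ := by
  classical
  have hfin : ∑' y, (G.cond x y : ℝ≥0∞) < ⊤ :=
    (ENNReal.tsum_coe_ne_top_iff_summable.2 (G.summable x)).lt_top
  have hle : ∀ a b : V, (G.cond a b : ℝ≥0∞) * ENNReal.ofReal
      ((Set.indicator {x} (1 : V → ℝ) a - Set.indicator {x} (1 : V → ℝ) b) ^ 2) ≤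
      (if a = x then (G.cond x b : ℝ≥0∞) else 0) +
        (if b = x then (G.cond x a : ℝ≥0∞) else 0) := by
    intro a b
    by_cases ha : a = x <;> by_cases hb : b = x
    · subst ha; subst hb; simp
    · subst ha; simp [hb]
    · subst hb; simp [ha, G.symm a b]
    · simp [ha, hb]
  unfold energy
  refine ENNReal.mul_lt_top (by simp) ?_
  refine lt_of_le_of_lt (ENNReal.tsum_le_tsum fun a => ENNReal.tsum_le_tsum fun b => hle a b) ?_
  simp only [ENNReal.tsum_add]
  refine ENNReal.add_lt_top.2 ⟨?_, ?_⟩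
  · rw [tsum_eq_single x (by intro a ha; simp [ha])]
    simpa using hfin
  · have : ∀ a : V, (∑' b, if b = x then (G.cond x a : ℝ≥0∞) else 0) = G.cond x a := by
      intro a
      rw [tsum_eq_single x (by intro b hb; simp [hb])]
      simp
    simpa [this] using hfin

theorem eq_of_res_eq_zero {x y : V} (h : G.res x y = 0) : x = y := by
  by_contra hne
  have := G.sq_le_res_mul (G.energy_indicator_lt_top x) x y
  rw [h, zero_mul] at this
  simp [Ne.symm hne] at this
  linarith

theorem energy_max_add_min (f : V → ℝ) (t : ℝ) :
    G.energy (fun x => max (f x) t) + G.energy (fun x => min (f x) t) ≤ G.energy f := by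
  unfold energy
  rw [← mul_add, ← ENNReal.tsum_add]
  gcongr with x
  rw [← ENNReal.tsum_add]
  gcongr with y
  rw [← mul_add, ← ENNReal.ofReal_add (sq_nonneg _) (sq_nonneg _)]
  gcongr
  rcases le_total (f x) t with h1 | h1 <;> rcases le_total (f y) t with h2 | h2 <;>
    simp only [h1, h2, max_eq_left, max_eq_right, min_eq_left, min_eq_right] <;>
    nlinarith [mul_nonneg (sub_nonneg.2 h1) (sub_nonneg.2 h2)]

theorem res_triangle (x y z : V) : G.res x z ≤ G.res x y + G.res y z := by
  set a := G.res x y with ha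
  set b := G.res y z with hb
  have ha0 : 0 ≤ a := G.res_nonneg x y
  have hb0 : 0 ≤ b := G.res_nonneg y z
  refine G.res_le (add_nonneg ha0 hb0) fun f hf => ?_
  have hE : 0 ≤ (G.energy f).toReal := ENNReal.toReal_nonneg
  have hxy := G.sq_le_res_mul hf x y
  have hyz := G.sq_le_res_mul hf y z
  have hsum := G.energy_max_add_min f (f y)
  have h1 : G.energy (fun v => max (f v) (f y)) < ⊤ :=
    lt_of_le_of_lt (le_self_add.trans hsum) hf
  have h2 : G.energy (fun v => min (f v) (f y)) < ⊤ :=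
    lt_of_le_of_lt (le_add_self.trans hsum) hf
  have hs : (G.energy (fun v => max (f v) (f y))).toReal +
      (G.energy (fun v => min (f v) (f y))).toReal ≤ (G.energy f).toReal := by
    rw [← ENNReal.toReal_add h1.ne h2.ne]
    exact ENNReal.toReal_mono hf.ne hsum
  have k1 := G.sq_le_res_mul h1 x y
  have k2 := G.sq_le_res_mul h2 y z
  have k3 := G.sq_le_res_mul h2 x y
  have k4 := G.sq_le_res_mul h1 y z
  rw [← ha] at hxy k1 k3
  rw [← hb] at hyz k2 k4
  set e := (G.energy f).toReal
  set e1 := (G.energy (fun v => max (f v) (f y))).toReal with he1'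
  set e2 := (G.energy (fun v => min (f v) (f y))).toReal with he2'
  have he1 : 0 ≤ e1 := ENNReal.toReal_nonneg
  have he2 : 0 ≤ e2 := ENNReal.toReal_nonneg
  -- Cauchy--Schwarz in the form that is needed
  have cs : ∀ p q s t : ℝ, 0 ≤ s → 0 ≤ t → s + t ≤ e → p ^ 2 ≤ a * s → q ^ 2 ≤ b * t →
      (p + q) ^ 2 ≤ (a + b) * e := by
    intro p q s t hs0 ht0 hst hp hq
    have hpq : 2 * (p * q) ≤ a * t + b * s := by
      have h4 : (p * q) ^ 2 ≤ (a * t) * (b * s) := by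
        calc (p * q) ^ 2 = p ^ 2 * q ^ 2 := by ring
          _ ≤ (a * s) * (b * t) := by
            apply mul_le_mul hp hq (sq_nonneg _) (by positivity)
          _ = _ := by ring
      have h5 : (2 * (p * q)) ^ 2 ≤ (a * t + b * s) ^ 2 := by
        nlinarith [sq_nonneg (a * t - b * s)]
      exact le_of_sq_le_sq h5 (by positivity)
    nlinarith [mul_le_mul_of_nonneg_left hst (add_nonneg ha0 hb0)]
  have mono : ∀ p q : ℝ, 0 ≤ p * q → q * q ≤ p * q → q ^ 2 ≤ p ^ 2 := by
    intro p q h h'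
    nlinarith [sq_nonneg (p - q)]
  rcases le_total (f x) (f y) with hx | hx <;> rcases le_total (f z) (f y) with hz | hz
  · rcases le_total (f x) (f z) with hxz | hxz
    · nlinarith [mul_nonneg hb0 hE]
    · nlinarith [mul_nonneg ha0 hE]
  · simp only [hx, hz, max_eq_left, min_eq_left, max_self, min_self] at k3 k4
    have := cs _ _ e2 e1 he2 he1 (by linarith) k3 k4
    simpa using this
  · simp only [hx, hz, max_eq_left, min_eq_left, max_self, min_self] at k1 k2
    have := cs _ _ e1 e2 he1 he2 hs k1 k2
    simpa using this
  · rcases le_total (f x) (f z) with hxz | hxz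
    · nlinarith [mul_nonneg ha0 hE]
    · nlinarith [mul_nonneg hb0 hE]

/-- The vertex set of the network, as a metric space with the resistance metric. -/
def Space {V : Type u} (_ : ElectricalNetwork V) : Type u := V

/-- The resistance metric on the vertex set. -/
noncomputable instance instMetricSpaceSpace : MetricSpace G.Space where
  dist := G.res
  dist_self := G.res_self
  dist_comm := G.res_comm
  dist_triangle := G.res_triangle
  eq_of_dist_eq_zero := G.eq_of_res_eq_zero

end ElectricalNetwork

/-! ### The local Gromov--Hausdorff metric -/

/-- The local Hausdorff metric `∫₀^∞ e^{-r} (1 ∧ d_H(A^{(r)}, B^{(r)})) dr` with root `o`,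
where `A^{(r)}` is the closure of the intersection of `A` with the open ball `B(o, r)`. -/
noncomputable def localHausdorffDist {M : Type u} [MetricSpace M] (o : M) (A B : Set M) : ℝ≥0∞ :=
  ∫⁻ r in Set.Ioi (0 : ℝ), ENNReal.ofReal (Real.exp (-r)) *
    min 1 (Metric.hausdorffEDist (closure (A ∩ Metric.ball o r)) (closure (B ∩ Metric.ball o r)))

/-- The local Gromov--Hausdorff metric between two rooted boundedly compact metric spaces
`(X, x)` and `(Y, y)`: the infimum of the local Hausdorff distances of their images under root- and
distance-preserving maps into a common rooted boundedly compact metric space `(M, o)`. -/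
noncomputable def localGHDist (X Y : Type u) [MetricSpace X] [MetricSpace Y] (x : X) (y : Y) :
    ℝ≥0∞ :=
  sInf {δ | ∃ (M : Type u) (_ : MetricSpace M) (_ : ProperSpace M) (o : M)
    (f : X → M) (g : Y → M), Isometry f ∧ Isometry g ∧ f x = o ∧ g y = o ∧
      δ = localHausdorffDist o (Set.range f) (Set.range g)}

/-! ### Fused conductances -/

/-- The conductances obtained from `c` by fusing the complement of `A` into one vertex,
which is denoted by `none`. -/
noncomputable def fusedCond {X : Type u} (c : X → X → ℝ) (A : Set X) : Option A → Option A → ℝ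
  | some x, some y => c x y
  | some x, none => ∑' y : (Aᶜ : Set X), c x y
  | none, some x => ∑' y : (Aᶜ : Set X), c x y
  | none, none => 0

/-! ### The setting -/

/-- The vertex sets `V n`, the sets `K N`, the networks `G n` on `V n`, and the compatible sequence
of networks `H n` on `V n`. -/
structure ApproxSetting (W : Type u) where
  /-- the root -/
  root : W
  /-- the vertex sets -/
  V : ℕ → Set W
  /-- the substitutes for balls -/
  K : ℕ → Set W
  V_mono : Monotone V
  K_mono : Monotone K
  V_countable : ∀ n, (V n).Countable
  root_mem_V : ∀ n, root ∈ V n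
  root_mem_K : ∀ N, root ∈ K N
  iUnion_V_subset : ⋃ n, V n ⊆ ⋃ N, K N
  finite_inter : ∀ n N, (V n ∩ K N).Finite
  /-- the approximating networks -/
  G : ∀ n, ElectricalNetwork (V n)
  /-- the compatible networks that define the limit -/
  H : ∀ n, ElectricalNetwork (V n)
  compatible : ∀ (m n : ℕ) (h : m ≤ n) (x y : V m),
    (H m).res x y = (H n).res (Set.inclusion (V_mono h) x) (Set.inclusion (V_mono h) y)

namespace ApproxSetting

variable {W : Type u} (S : ApproxSetting W)

/-- The union of the vertex sets. -/
def Vtot : Type u := ↥(⋃ n, S.V n)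

theorem exists_mem (x : S.Vtot) : ∃ n, x.1 ∈ S.V n := Set.mem_iUnion.1 x.2

open Classical in
/-- The first level that contains `x`. -/
noncomputable def level (x : S.Vtot) : ℕ := Nat.find (S.exists_mem x)

open Classical in
theorem mem_of_level_le {x : S.Vtot} {n : ℕ} (h : S.level x ≤ n) : x.1 ∈ S.V n :=
  S.V_mono h (Nat.find_spec (S.exists_mem x))

/-- The resistance metric `R` on the union of the vertex sets: on each `V n` it is the resistance
metric of `H n` (see `resTot_eq`). -/
noncomputable def resTot (x y : S.Vtot) : ℝ :=
  (S.H (max (S.level x) (S.level y))).res ⟨x.1, S.mem_of_level_le (le_max_left _ _)⟩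
    ⟨y.1, S.mem_of_level_le (le_max_right _ _)⟩

theorem resTot_eq (x y : S.Vtot) (n : ℕ) (hx : x.1 ∈ S.V n) (hy : y.1 ∈ S.V n) :
    S.resTot x y = (S.H n).res ⟨x.1, hx⟩ ⟨y.1, hy⟩ := by
  rcases le_total (max (S.level x) (S.level y)) n with h | h
  · exact S.compatible _ _ h _ _
  · exact (S.compatible _ _ h ⟨x.1, hx⟩ ⟨y.1, hy⟩).symm

noncomputable instance instMetricSpaceVtot : MetricSpace S.Vtot where
  dist := S.resTot
  dist_self x := (S.H _).res_self _
  dist_comm x y := by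
    have hx : x.1 ∈ S.V (max (S.level x) (S.level y)) := S.mem_of_level_le (le_max_left _ _)
    have hy : y.1 ∈ S.V (max (S.level x) (S.level y)) := S.mem_of_level_le (le_max_right _ _)
    rw [S.resTot_eq x y _ hx hy, S.resTot_eq y x _ hy hx, ElectricalNetwork.res_comm]
  dist_triangle x y z := by
    have hx : x.1 ∈ S.V (max (S.level x) (max (S.level y) (S.level z))) :=
      S.mem_of_level_le (le_max_left _ _)
    have hy : y.1 ∈ S.V (max (S.level x) (max (S.level y) (S.level z))) :=
      S.mem_of_level_le ((le_max_left _ _).trans (le_max_right _ _))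
    have hz : z.1 ∈ S.V (max (S.level x) (max (S.level y) (S.level z))) :=
      S.mem_of_level_le ((le_max_right _ _).trans (le_max_right _ _))
    rw [S.resTot_eq x y _ hx hy, S.resTot_eq y z _ hy hz, S.resTot_eq x z _ hx hz]
    exact ElectricalNetwork.res_triangle _ _ _ _
  eq_of_dist_eq_zero {x y} h := by
    have := ElectricalNetwork.eq_of_res_eq_zero _ h
    exact Subtype.ext (Subtype.mk.inj this)

/-- The limit space `(F, R)`, the completion of the union of the vertex sets. -/
abbrev F : Type u := UniformSpace.Completion S.Vtot

/-- The root as a point of `V n`. -/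
def rootV (n : ℕ) : S.V n := ⟨S.root, S.root_mem_V n⟩

/-- The root as a point of the union of the vertex sets. -/
def rootTot : S.Vtot := ⟨S.root, Set.mem_iUnion.2 ⟨0, S.root_mem_V 0⟩⟩

/-- The root as a point of the completion. -/
noncomputable def rootF : S.F := (S.rootTot : UniformSpace.Completion S.Vtot)

open Classical in
/-- The resistance metric `R_n` of `G n` as a function on `W × W`. It is only used at points of `V n`
(its value `0` elsewhere plays no role). -/
noncomputable def resG (n : ℕ) (x y : W) : ℝ≥0∞ :=
  if h : x ∈ S.V n ∧ y ∈ S.V n then ENNReal.ofReal ((S.G n).res ⟨x, h.1⟩ ⟨y, h.2⟩) else 0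

/-- The part `K N` of the vertex set `V n`. -/
def KV (n N : ℕ) : Set (S.V n) := {x | x.1 ∈ S.K N}

/-- The conductances on `V m` of the trace of `G n` onto `V m`, for `m ≤ n`
(the value `0` for `n < m` plays no role). -/
noncomputable def traceG (n m : ℕ) (x y : S.V m) : ℝ :=
  if h : m ≤ n then
    (S.G n).traceCond (Set.range (Set.inclusion (S.V_mono h)))
      (Set.inclusion (S.V_mono h) x) (Set.inclusion (S.V_mono h) y)
  else 0

/-- The assumption on the approximating networks. -/
structure Approximation : Prop where
  /-- neighbourhood maps -/
  neighbourhood : ∃ g : ∀ m, S.Vtot → S.V m,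
    (∀ m N (x : S.Vtot), x.1 ∈ S.K N → (g m x).1 ∈ S.K N) ∧
    (∀ m N (x : S.Vtot), x.1 ∉ S.K N → (g m x).1 ∉ S.K N) ∧
    Tendsto (fun m => limsup (fun n => ⨆ x : S.V n,
      S.resG n x.1 (g m ⟨x.1, Set.mem_iUnion.2 ⟨n, x.2⟩⟩).1) atTop) atTop (𝓝 0) ∧
    Tendsto (fun m => ⨆ x : S.Vtot,
      edist x (⟨(g m x).1, Set.mem_iUnion.2 ⟨m, (g m x).2⟩⟩ : S.Vtot)) atTop (𝓝 0)
  /-- bounds on each `V m ∩ K N` -/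
  bounded : ∀ m N, limsup (fun n => ⨆ x : S.KV m N, S.resG n S.root x.1.1) atTop < ⊤
  /-- non-explosion on the increasing sets -/
  nonexplosion : Tendsto (fun N => limsup (fun n =>
    effRes (S.G n).energy {S.rootV n} (S.KV n N)ᶜ) atTop) atTop (𝓝 ⊤)
  /-- convergence of the fused trace conductances -/
  conductance : ∀ m N (x y : Option (S.KV m N)),
    Tendsto (fun n => fusedCond (S.traceG n m) (S.KV m N) x y) atTop
      (𝓝 (fusedCond (fun v w => ((S.H m).cond v w : ℝ)) (S.KV m N) x y))

end ApproxSetting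

/-! Recurrence is used through cutoff functions: finitely supported functions that tend to 1
pointwise and to 0 in energy (`HasCutoffs`). They show that a trace loses no mass: the trace
conductances at `x` sum to the energy of the harmonic extension of the indicator of `x`
(`hasSum_traceAlong`). So the harmonic extension of a function supported on the finite set `V m ∩ K
N` has an energy that is a finite expression in the fused conductances
(`bil_sum_harm_eq_fusedEnergy`).

Convergence of the fused conductances then works like Γ-convergence. Lower bound
(`Approximation.energy_le_of_tendsto`): a pointwise limit of `[0,1]`-valued functions on the `G n`
with energy at most `C` has energy at most `C` on every `H m`. Upper bound (`exists_recovery`): a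
function on `V m` that vanishes off `K N` extends harmonically to `G n`, with convergent energies.
Applied to potentials, the two bounds give convergence of the resistances between fixed points.

Non-explosion is assumed only as a limsup in `n`, hence along a subsequence. Cutoffs along an
ultrafilter converge to a function of small energy on all `H m`, supported in `K N`
(`exists_limit_cutoff`). Its recovery sequence lives on every large `G n`, and the neighbourhood
maps control it off `V m`, so a truncation is again a cutoff (`eventually_exists_cutoff`). Thus
points off `K N` are far from the root, uniformly in large `n` and in the limit, while `K N` is
bounded. The sets `K N` can therefore replace balls, the finite sets `V m ∩ K N` are nets of balls
at any given scale, and convergence of resistances on these nets is local Gromov–Hausdorff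
convergence.

The limit form is the supremum over `m` of the energies of the restrictions to `V m`. These increase
in `m` because resistances alone determine the comparison of energies (`energy_comp_le_of_res_eq`).
The potential of a unit current is half a difference of distances, so it makes sense on the
completion and shows that the form has resistance metric `R`. -/

namespace ElectricalNetwork

variable {V : Type u} (G : ElectricalNetwork V)

/-! ### The energy as a quadratic form -/

/-- The contribution of an oriented edge to twice the energy form. -/
noncomputable def edgeTerm (f g : V → ℝ) (p : V × V) : ℝ :=
  (G.cond p.1 p.2 : ℝ) * (f p.1 - f p.2) * (g p.1 - g p.2)

theorem edgeTerm_self_nonneg (f : V → ℝ) (p : V × V) : 0 ≤ G.edgeTerm f f p := by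
  unfold edgeTerm
  rw [mul_assoc]
  exact mul_nonneg (NNReal.coe_nonneg _) (mul_self_nonneg _)

theorem energy_eq_tsum (f : V → ℝ) :
    G.energy f = ∑' p : V × V, 2⁻¹ * ENNReal.ofReal (G.edgeTerm f f p) := by
  rw [ENNReal.tsum_mul_left, ENNReal.tsum_prod', energy]
  congr 1
  refine tsum_congr fun x => tsum_congr fun y => ?_
  rw [edgeTerm, mul_assoc, ENNReal.ofReal_mul (NNReal.coe_nonneg _), ENNReal.ofReal_coe_nnreal, sq]

/-- Each edge contributes a nonnegative continuous function of two coordinates. This Fatou property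
for pointwise convergence yields the minimisers and the later bounds on energies of limits. -/
theorem lowerSemicontinuous_energy : LowerSemicontinuous G.energy := by
  have : G.energy = fun f => ∑' p : V × V, 2⁻¹ * ENNReal.ofReal (G.edgeTerm f f p) :=
    funext G.energy_eq_tsum
  rw [this]
  refine lowerSemicontinuous_tsum fun p => Continuous.lowerSemicontinuous ?_
  refine (ENNReal.continuous_const_mul (by simp)).comp (ENNReal.continuous_ofReal.comp ?_)
  unfold edgeTerm
  fun_prop

theorem isClosed_energy_le (C : ℝ≥0∞) : IsClosed {f | G.energy f ≤ C} :=
  G.lowerSemicontinuous_energy.isClosed_preimage C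

theorem energy_le_of_tendsto {ι : Type*} {l : Filter ι} [l.NeBot] {F : ι → V → ℝ} {f : V → ℝ}
    {C : ℝ≥0∞} (h : ∀ x, Tendsto (fun i => F i x) l (𝓝 (f x)))
    (hC : ∀ᶠ i in l, G.energy (F i) ≤ C) : G.energy f ≤ C :=
  (G.isClosed_energy_le C).mem_of_tendsto (tendsto_pi_nhds.2 h) hC

theorem energy_lt_top_iff (f : V → ℝ) : G.energy f < ⊤ ↔ Summable (G.edgeTerm f f) := by
  rw [energy_eq_tsum, ENNReal.tsum_mul_left]
  constructor
  · intro h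
    have h1 : ∑' p, ENNReal.ofReal (G.edgeTerm f f p) ≠ ⊤ := by
      intro h2
      rw [h2] at h
      simp at h
    refine (ENNReal.summable_toReal h1).congr fun p => ?_
    exact ENNReal.toReal_ofReal (G.edgeTerm_self_nonneg f p)
  · intro h
    exact ENNReal.mul_lt_top (by simp) h.tsum_ofReal_lt_top

theorem energy_eq_ofReal {f : V → ℝ} (hf : G.energy f < ⊤) :
    G.energy f = ENNReal.ofReal (G.form f f) := by
  have hs := (G.energy_lt_top_iff f).1 hf
  rw [energy_eq_tsum, ENNReal.tsum_mul_left,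
    ← ENNReal.ofReal_tsum_of_nonneg (G.edgeTerm_self_nonneg f) hs]
  rw [form, ENNReal.ofReal_mul (by norm_num)]
  congr 1
  rw [ENNReal.ofReal_inv_of_pos (by norm_num)]
  simp

theorem form_self_nonneg (f : V → ℝ) : 0 ≤ G.form f f :=
  mul_nonneg (by norm_num) (tsum_nonneg (G.edgeTerm_self_nonneg f))

theorem toReal_energy {f : V → ℝ} (hf : G.energy f < ⊤) : (G.energy f).toReal = G.form f f := by
  rw [G.energy_eq_ofReal hf, ENNReal.toReal_ofReal (G.form_self_nonneg f)]

theorem summable_edgeTerm {f g : V → ℝ} (hf : G.energy f < ⊤) (hg : G.energy g < ⊤) :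
    Summable (G.edgeTerm f g) := by
  have h1 := (G.energy_lt_top_iff f).1 hf
  have h2 := (G.energy_lt_top_iff g).1 hg
  refine Summable.of_norm_bounded (h1.add h2) fun p => ?_
  have hc : (0 : ℝ) ≤ G.cond p.1 p.2 := NNReal.coe_nonneg _
  unfold edgeTerm
  rw [mul_assoc, norm_mul, Real.norm_of_nonneg hc, mul_assoc, mul_assoc, ← mul_add]
  refine mul_le_mul_of_nonneg_left ?_ hc
  rw [Real.norm_eq_abs, abs_le]
  constructor <;> nlinarith [sq_nonneg (f p.1 - f p.2 + (g p.1 - g p.2)),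
    sq_nonneg (f p.1 - f p.2 - (g p.1 - g p.2)), sq_nonneg (f p.1 - f p.2),
    sq_nonneg (g p.1 - g p.2)]

theorem form_eq (f g : V → ℝ) : G.form f g = 2⁻¹ * ∑' p, G.edgeTerm f g p := rfl

theorem form_comm (f g : V → ℝ) : G.form f g = G.form g f := by
  unfold form
  congr 1
  exact tsum_congr fun p => by ring

theorem energy_const (a : ℝ) : G.energy (fun _ => a) = 0 := by
  simp [energy]

theorem energy_add_const (f : V → ℝ) (a : ℝ) : G.energy (fun x => f x + a) = G.energy f := by
  simp [energy]

theorem energy_sub_const (f : V → ℝ) (a : ℝ) : G.energy (fun x => f x - a) = G.energy f := by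
  simp [energy]

theorem energy_lipschitz_le {f g : V → ℝ} (h : ∀ x y, |g x - g y| ≤ |f x - f y|) :
    G.energy g ≤ G.energy f := by
  unfold energy
  refine mul_le_mul_right (ENNReal.tsum_le_tsum fun x => ENNReal.tsum_le_tsum fun y => ?_) _
  exact mul_le_mul_right (ENNReal.ofReal_le_ofReal (sq_le_sq.2 (h x y))) _

theorem energy_clamp_le (f : V → ℝ) (a b : ℝ) :
    G.energy (fun x => max (min (f x) b) a) ≤ G.energy f := by
  refine G.energy_lipschitz_le fun x y => ?_
  exact (abs_max_sub_max_le_abs _ _ _).trans (by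
    have := abs_min_sub_min_le_max (f x) b (f y) b
    simpa using this)

/-- Functions of finite energy. -/
def dom : Submodule ℝ (V → ℝ) where
  carrier := {f | G.energy f < ⊤}
  zero_mem' := by
    change G.energy (fun _ => 0) < ⊤
    rw [G.energy_const]
    exact ENNReal.zero_lt_top
  add_mem' := by
    intro f g hf hg
    change G.energy _ < ⊤
    have h1 := (G.energy_lt_top_iff f).1 hf
    have h2 := (G.energy_lt_top_iff g).1 hg
    have h3 := G.summable_edgeTerm hf hg
    rw [G.energy_lt_top_iff]
    refine ((h1.add h2).add (h3.mul_left 2)).congr fun p => ?_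
    simp only [edgeTerm, Pi.add_apply]
    ring
  smul_mem' := by
    intro a f hf
    change G.energy _ < ⊤
    rw [G.energy_lt_top_iff]
    refine (((G.energy_lt_top_iff f).1 hf).mul_left (a ^ 2)).congr fun p => ?_
    simp only [edgeTerm, Pi.smul_apply, smul_eq_mul]
    ring

theorem mem_dom {f : V → ℝ} : f ∈ G.dom ↔ G.energy f < ⊤ := Iff.rfl

theorem const_mem_dom (a : ℝ) : (fun _ => a) ∈ G.dom := by
  rw [mem_dom, energy_const]
  exact ENNReal.zero_lt_top

theorem indicator_mem_dom (x : V) : Set.indicator {x} 1 ∈ G.dom := G.energy_indicator_lt_top x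

/-- The energy form as a bilinear form on the functions of finite energy. -/
noncomputable def bil : G.dom →ₗ[ℝ] G.dom →ₗ[ℝ] ℝ :=
  LinearMap.mk₂ ℝ (fun f g => G.form f g)
    (by
      intro f g h
      simp only [form_eq, ← mul_add]
      rw [← (G.summable_edgeTerm f.2 h.2).tsum_add (G.summable_edgeTerm g.2 h.2)]
      congr 1
      refine tsum_congr fun p => ?_
      simp only [edgeTerm, Submodule.coe_add, Pi.add_apply]
      ring)
    (by
      intro a f g
      simp only [form_eq, smul_eq_mul]
      rw [mul_left_comm, ← tsum_mul_left (a := a)]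
      congr 1
      refine tsum_congr fun p => ?_
      simp only [edgeTerm, Submodule.coe_smul, Pi.smul_apply, smul_eq_mul]
      ring)
    (by
      intro f g h
      simp only [form_eq, ← mul_add]
      rw [← (G.summable_edgeTerm f.2 g.2).tsum_add (G.summable_edgeTerm f.2 h.2)]
      congr 1
      refine tsum_congr fun p => ?_
      simp only [edgeTerm, Submodule.coe_add, Pi.add_apply]
      ring)
    (by
      intro a f g
      simp only [form_eq, smul_eq_mul]
      rw [mul_left_comm, ← tsum_mul_left (a := a)]
      congr 1
      refine tsum_congr fun p => ?_
      simp only [edgeTerm, Submodule.coe_smul, Pi.smul_apply, smul_eq_mul]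
      ring)

theorem bil_apply (f g : G.dom) : G.bil f g = G.form f g := rfl

theorem bil_comm (f g : G.dom) : G.bil f g = G.bil g f := G.form_comm _ _

theorem bil_self_nonneg (f : G.dom) : 0 ≤ G.bil f f := G.form_self_nonneg _

theorem energy_coe (f : G.dom) : G.energy f = ENNReal.ofReal (G.bil f f) := G.energy_eq_ofReal f.2

theorem toReal_energy_coe (f : G.dom) : (G.energy f).toReal = G.bil f f := G.toReal_energy f.2

theorem bil_add_smul (f g : G.dom) (t : ℝ) :
    G.bil (f + t • g) (f + t • g) = G.bil f f + 2 * t * G.bil f g + t ^ 2 * G.bil g g := by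
  simp only [map_add, map_smul, LinearMap.add_apply, LinearMap.smul_apply, smul_eq_mul,
    G.bil_comm g f]
  ring

theorem bil_sq_le (f g : G.dom) : G.bil f g ^ 2 ≤ G.bil f f * G.bil g g := by
  have h : ∀ t : ℝ, 0 ≤ G.bil g g * (t * t) + 2 * G.bil f g * t + G.bil f f := fun t => by
    have := G.bil_self_nonneg (f + t • g)
    rw [G.bil_add_smul] at this
    linarith
  have := discrim_le_zero h
  rw [discrim] at this
  nlinarith

theorem bil_const_right (f : G.dom) (a : ℝ) : G.bil f ⟨fun _ => a, G.const_mem_dom a⟩ = 0 := by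
  simp [bil_apply, form]

theorem sq_sub_le (f : G.dom) (x y : V) : (f.1 x - f.1 y) ^ 2 ≤ G.res x y * G.bil f f := by
  rw [← G.toReal_energy_coe]
  exact G.sq_le_res_mul f.2 x y

/-! ### Harmonic functions -/

/-- Clamping to `[a, b]` keeps the boundary values and does not raise the energy, so it suffices to
minimise over a product of compact intervals. -/
theorem exists_energy_minimizer (B : Set V) (φ : V → ℝ) {a b : ℝ} (hab : a ≤ b)
    (h : ∀ x ∈ B, φ x ∈ Icc a b) :
    ∃ f : V → ℝ, (∀ x ∈ B, f x = φ x) ∧ (∀ x, f x ∈ Icc a b) ∧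
      ∀ v : V → ℝ, (∀ x ∈ B, v x = φ x) → G.energy f ≤ G.energy v := by
  have clamp : ∀ v : V → ℝ, (∀ x ∈ B, v x = φ x) → ∀ x ∈ B, max (min (v x) b) a = φ x := by
    intro v hv x hx
    rw [hv x hx, min_eq_left (h x hx).2, max_eq_left (h x hx).1]
  have clampI : ∀ (v : V → ℝ) x, max (min (v x) b) a ∈ Icc a b := fun v x =>
    ⟨le_max_right _ _, max_le (min_le_right _ _) hab⟩
  set K : Set (V → ℝ) := Set.pi univ (fun _ => Icc a b) ∩ {f | ∀ x ∈ B, f x = φ x}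
  have hK : IsCompact K := by
    refine (isCompact_univ_pi fun _ => isCompact_Icc).inter_right ?_
    have : {f : V → ℝ | ∀ x ∈ B, f x = φ x} = ⋂ x ∈ B, {f | f x = φ x} := by
      ext f; simp
    rw [this]
    exact isClosed_biInter fun x _ => isClosed_eq (continuous_apply x) continuous_const
  have hne : K.Nonempty := ⟨fun x => max (min (φ x) b) a,
    fun x _ => clampI φ x, clamp φ fun _ _ => rfl⟩
  obtain ⟨f, hf, hmin⟩ := LowerSemicontinuousOn.exists_isMinOn hne hK
    (G.lowerSemicontinuous_energy.lowerSemicontinuousOn K)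
  refine ⟨f, hf.2, fun x => hf.1 x (mem_univ x), fun v hv => ?_⟩
  exact (isMinOn_iff.1 hmin _ ⟨fun x _ => clampI v x, clamp v hv⟩).trans (G.energy_clamp_le v a b)

/-- First variation: the quadratic polynomial `t ↦ E(f + t w) - E(f)` is nonnegative and has no
constant term, so its linear coefficient vanishes. -/
theorem bil_eq_zero_of_minimal {B : Set V} (f : G.dom)
    (hf : ∀ v : V → ℝ, (∀ x ∈ B, v x = f.1 x) → G.energy f ≤ G.energy v)
    (w : G.dom) (hw : ∀ x ∈ B, w.1 x = 0) : G.bil f w = 0 := by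
  have key : ∀ t : ℝ, 0 ≤ G.bil w w * (t * t) + 2 * G.bil f w * t + 0 := fun t => by
    have h1 := hf (f + t • w : G.dom) (fun x hx => by simp [hw x hx])
    rw [G.energy_coe, G.energy_coe, ENNReal.ofReal_le_ofReal_iff (G.bil_self_nonneg _),
      G.bil_add_smul] at h1
    linarith
  have := discrim_le_zero key
  rw [discrim] at this
  nlinarith [sq_nonneg (G.bil f w)]

/-! ### Potentials -/

/-- One inequality tests the supremum that defines the resistance with `u` itself; the other is
Cauchy–Schwarz. -/
theorem bil_self_of_reproducing {u : G.dom} {x y : V} (hu : ∀ w : G.dom, G.bil u w = w.1 x - w.1 y) :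
    G.bil u u = G.res x y := by
  have h0 := G.bil_self_nonneg u
  apply le_antisymm
  · rcases h0.eq_or_lt with h | h
    · rw [← h]; exact G.res_nonneg x y
    · have h1 := G.sq_sub_le u x y
      rw [← hu u, sq] at h1
      exact le_of_mul_le_mul_right h1 h
  · refine G.res_le h0 fun f hf => ?_
    have h1 := G.bil_sq_le u ⟨f, hf⟩
    rw [hu, ← G.toReal_energy_coe ⟨f, hf⟩] at h1
    exact h1

theorem exists_unit_potential {x y : V} (hxy : x ≠ y) :
    ∃ h : G.dom, h.1 x = 1 ∧ h.1 y = 0 ∧ (∀ z, h.1 z ∈ Icc (0 : ℝ) 1) ∧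
      ∀ w : G.dom, G.bil h w = (G.res x y)⁻¹ * (w.1 x - w.1 y) := by
  classical
  obtain ⟨f, hfB, hfI, hmin⟩ := G.exists_energy_minimizer {x, y} (Set.indicator {x} 1)
    (zero_le_one (α := ℝ)) (by
      rintro z (rfl | rfl)
      · simp
      · simp [hxy.symm])
  have hfd : f ∈ G.dom :=
    (hmin _ fun _ _ => rfl).trans_lt (G.energy_indicator_lt_top x)
  have hx : f x = 1 := by simpa using hfB x (by simp)
  have hy : f y = 0 := by simpa [hxy.symm] using hfB y (by simp)
  set h : G.dom := ⟨f, hfd⟩ with hh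
  have orth : ∀ w : G.dom, w.1 x = 0 → w.1 y = 0 → G.bil h w = 0 := by
    intro w hwx hwy
    refine G.bil_eq_zero_of_minimal (B := {x, y}) h (fun v hv => hmin v fun z hz => ?_) w ?_
    · rw [hv z hz, ← hfB z hz]
    · rintro z (rfl | rfl) <;> assumption
  have rep : ∀ w : G.dom, G.bil h w = G.bil h h * (w.1 x - w.1 y) := by
    intro w
    -- Subtracting the constant `w y` and the right multiple of `h` makes `w` vanish at both points.
    have h1 := orth (w - ⟨fun _ => w.1 y, G.const_mem_dom _⟩ - (w.1 x - w.1 y) • h)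
      (by simp [hh, hx]) (by simp [hh, hy])
    rw [map_sub, map_sub, map_smul, G.bil_const_right, smul_eq_mul] at h1
    linarith
  have hpos : 0 < G.bil h h := by
    have h1 := G.sq_sub_le h x y
    have h2 := G.bil_self_nonneg h
    rcases h2.eq_or_lt with h3 | h3
    · rw [← h3] at h1; simp [hh, hx, hy] at h1; linarith
    · exact h3
  refine ⟨h, hx, hy, hfI, fun w => ?_⟩
  have : G.res x y = (G.bil h h)⁻¹ := by
    rw [← G.bil_self_of_reproducing (u := (G.bil h h)⁻¹ • h) (x := x) (y := y)]
    · simp [hpos.ne']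
    · intro w
      rw [map_smul, LinearMap.smul_apply, rep w, smul_eq_mul, ← mul_assoc,
        inv_mul_cancel₀ hpos.ne', one_mul]
  rw [this, inv_inv, rep]

theorem res_pos {x y : V} (hxy : x ≠ y) : 0 < G.res x y :=
  (G.res_nonneg x y).lt_of_ne fun h => hxy (G.eq_of_res_eq_zero h.symm)

theorem exists_reproducing (x y : V) : ∃ u : G.dom, ∀ w : G.dom, G.bil u w = w.1 x - w.1 y := by
  rcases eq_or_ne x y with rfl | hxy
  · exact ⟨0, fun w => by simp⟩
  · obtain ⟨h, -, -, -, hh⟩ := G.exists_unit_potential hxy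
    refine ⟨G.res x y • h, fun w => ?_⟩
    rw [map_smul, LinearMap.smul_apply, hh, smul_eq_mul, ← mul_assoc,
      mul_inv_cancel₀ (G.res_pos hxy).ne', one_mul]

/-- The potential of a unit current from `x` to `y`, in terms of the resistance metric. -/
noncomputable def pot (x y : V) (z : V) : ℝ := (G.res z y - G.res z x) / 2

/-- If `k z` represents `w ↦ w z - w y`, then `k a - k b` has energy `R(a,b)`, so polarisation
expresses `E(k a, k b)` by resistances. Evaluating at `b = x` gives `k x` up to a constant. The
resulting formula mentions only `R`, which makes potentials of different networks comparable. -/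
theorem exists_pot (x y : V) :
    ∃ h : G.pot x y ∈ G.dom, ∀ w : G.dom, G.bil ⟨_, h⟩ w = w.1 x - w.1 y := by
  choose k hk using fun z => G.exists_reproducing z y
  have hkk : ∀ a b, G.bil (k a) (k b) = (G.res a y + G.res b y - G.res a b) / 2 := by
    intro a b
    have h1 := G.bil_self_of_reproducing (u := k a - k b) (x := a) (y := b) (fun w => by
      rw [map_sub, LinearMap.sub_apply, hk, hk]; ring)
    simp only [map_sub, LinearMap.sub_apply, G.bil_self_of_reproducing (hk a),
      G.bil_self_of_reproducing (hk b), G.bil_comm (k b) (k a)] at h1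
    linarith
  have hval : G.pot x y = fun z => (k x).1 z + (-(k x).1 y - G.res x y / 2) := by
    funext z
    have h1 := hkk z x
    rw [hk z] at h1
    rw [pot]
    linarith
  have hmem : G.pot x y ∈ G.dom := by
    rw [hval, mem_dom, energy_add_const]
    exact (k x).2
  refine ⟨hmem, fun w => ?_⟩
  have : (⟨_, hmem⟩ : G.dom) = k x + ⟨fun _ => -(k x).1 y - G.res x y / 2, G.const_mem_dom _⟩ :=
    Subtype.ext hval
  rw [this, map_add, LinearMap.add_apply, hk, G.bil_comm _ w, G.bil_const_right, add_zero]

theorem energy_pot (x y : V) : G.energy (G.pot x y) = ENNReal.ofReal (G.res x y) := by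
  obtain ⟨h, hh⟩ := G.exists_pot x y
  rw [← G.bil_self_of_reproducing hh, ← energy_coe]

/-! ### Comparison of networks with the same resistances -/

/-- For a finite set `A`, the energy minimiser `h` with values `f ∘ i` on `A` is harmonic off `A`,
so its energy pairing is given by charges `c` on `A` of total 0. The same charges generate a
potential `k'` on the larger network, and `k' ∘ i` is the potential `k` of `c` on the smaller one,
as both depend only on resistances. Hence `k'` has the energy of `h`, and its pairing with `f` is
also `E(h,h)`; Cauchy–Schwarz gives `E(h,h) ≤ E'(f,f)`. Exhausting by finite sets and using lower
semicontinuity finishes. -/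
theorem energy_comp_le_of_res_eq {V' : Type u} (G' : ElectricalNetwork V') (i : V → V')
    (hi : ∀ x y, G.res x y = G'.res (i x) (i y)) (f : V' → ℝ) :
    G.energy (f ∘ i) ≤ G'.energy f := by
  classical
  rcases eq_or_ne (G'.energy f) ⊤ with htop | htop
  · rw [htop]; exact le_top
  set f' : G'.dom := ⟨f, htop.lt_top⟩ with hf'
  obtain ⟨ρ⟩ : Nonempty V := G.connected.nonempty
  have hpot : ∀ a z, G'.pot (i a) (i ρ) (i z) = G.pot a ρ z := fun a z => by
    simp only [pot, hi]
  choose hm hk using fun a => G.exists_pot a ρ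
  choose hm' hk' using fun a => G'.exists_pot (i a) (i ρ)
  set e : V → G.dom := fun a => ⟨Set.indicator {a} 1, G.indicator_mem_dom a⟩ with he
  have hfin : ∀ A : Finset V, ∃ h : V → ℝ, (∀ x ∈ A, h x = f (i x)) ∧ G.energy h ≤ G'.energy f := by
    intro A
    set v : (V → ℝ) → G.dom := fun φ => ∑ a ∈ A, φ a • e a with hv
    have hvA : ∀ φ, ∀ x ∈ A, (v φ).1 x = φ x := by
      intro φ x hx
      simp only [hv, AddSubmonoidClass.coe_finsetSum, Finset.sum_apply, Submodule.coe_smul,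
        Pi.smul_apply, he, smul_eq_mul, Set.indicator_apply, Set.mem_singleton_iff, Pi.one_apply,
        mul_ite, mul_one, mul_zero, Finset.sum_ite_eq, hx, if_true]
    set b : ℝ := ∑ a ∈ A, |f (i a)| with hb
    have hbound : ∀ x ∈ (A : Set V), f (i x) ∈ Icc (-b) b := fun x hx => by
      have : |f (i x)| ≤ b := Finset.single_le_sum (f := fun a => |f (i a)|)
        (fun _ _ => abs_nonneg _) hx
      exact abs_le.1 this
    have hb0 : 0 ≤ b := Finset.sum_nonneg fun _ _ => abs_nonneg _
    obtain ⟨h0, hA, -, hmin⟩ := G.exists_energy_minimizer (A : Set V) (f ∘ i)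
      (by linarith : -b ≤ b) hbound
    have hd : h0 ∈ G.dom := (hmin (v (f ∘ i)) (hvA (f ∘ i))).trans_lt (v (f ∘ i)).2
    set h : G.dom := ⟨h0, hd⟩ with hh
    set c : V → ℝ := fun a => G.bil h (e a) with hc
    have hw : ∀ w : G.dom, G.bil h w = ∑ a ∈ A, w.1 a * c a := by
      intro w
      have h1 := G.bil_eq_zero_of_minimal (B := (A : Set V)) h
        (fun x hx => hmin x fun z hz => (hx z hz).trans (hA z hz)) (w - v w.1)
        (fun x hx => by simp [hvA w.1 x hx])
      rw [map_sub, sub_eq_zero] at h1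
      rw [h1, hv]
      simp [hc]
    -- Total charge zero makes the choice of the reference vertex `ρ` in the potentials immaterial.
    have hc0 : ∑ a ∈ A, c a = 0 := by
      have := hw ⟨fun _ => 1, G.const_mem_dom 1⟩
      rw [G.bil_const_right] at this
      simpa using this.symm
    have hE : G.bil h h = ∑ a ∈ A, f (i a) * c a := by
      rw [hw]
      exact Finset.sum_congr rfl fun a ha => congrArg (· * c a) (hA a ha)
    set k : G.dom := ∑ a ∈ A, c a • ⟨_, hm a⟩ with hkdef
    set k' : G'.dom := ∑ a ∈ A, c a • ⟨_, hm' a⟩ with hk'def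
    have hkk' : ∀ z, k'.1 (i z) = k.1 z := by
      intro z
      simp [hkdef, hk'def, hpot]
    have hk'w : ∀ w : G'.dom, G'.bil k' w = ∑ a ∈ A, w.1 (i a) * c a := by
      intro w
      simp only [hk'def, map_sum, map_smul, LinearMap.sum_apply, LinearMap.smul_apply, hk',
        smul_eq_mul, mul_sub, Finset.sum_sub_distrib, ← Finset.sum_mul, hc0, zero_mul, sub_zero]
      exact Finset.sum_congr rfl fun _ _ => mul_comm _ _
    have hkw : ∀ w : G.dom, G.bil k w = ∑ a ∈ A, w.1 a * c a := by
      intro w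
      simp only [hkdef, map_sum, map_smul, LinearMap.sum_apply, LinearMap.smul_apply, hk,
        smul_eq_mul, mul_sub, Finset.sum_sub_distrib, ← Finset.sum_mul, hc0, zero_mul, sub_zero]
      exact Finset.sum_congr rfl fun _ _ => mul_comm _ _
    have hEk : G'.bil k' k' = G.bil h h := by
      rw [hk'w]
      simp only [hkk']
      rw [← hw, G.bil_comm, hkw, hw]
    have hcs := G'.bil_sq_le k' f'
    rw [hEk, hk'w, hf', ← hE, sq] at hcs
    refine ⟨h0, hA, ?_⟩
    change G.energy h ≤ G'.energy f'
    rw [G.energy_coe, G'.energy_coe]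
    apply ENNReal.ofReal_le_ofReal
    rcases (G.bil_self_nonneg h).eq_or_lt with h3 | h3
    · rw [← h3]; exact G'.bil_self_nonneg _
    · exact le_of_mul_le_mul_left hcs h3
  choose h hA hE using hfin
  refine G.energy_le_of_tendsto (l := atTop) (F := h) (fun x => ?_) (Eventually.of_forall hE)
  refine tendsto_const_nhds.congr' ?_
  filter_upwards [eventually_ge_atTop {x}] with A hxA
  exact (hA A x (hxA (Finset.mem_singleton_self x))).symm

end ElectricalNetwork

/-! ### Fused energies -/

/-- Writing `2 f(x) f(y) = f(x)² + f(y)² - (f(x) - f(y))²` splits the form into a mass term, which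
measures killing, and a Dirichlet sum. -/
theorem sum_mul_mul_eq {X : Type*} (A : Finset X) (T c : X → X → ℝ)
    (hsymm : ∀ x y, c x y = c y x) (hdiag : ∀ x, c x x = 0) (hT : ∀ x y, x ≠ y → T x y = -c x y)
    (f : X → ℝ) :
    ∑ x ∈ A, ∑ y ∈ A, f x * f y * T x y =
      ∑ x ∈ A, f x ^ 2 * (T x x - ∑ y ∈ A, c x y) +
        2⁻¹ * ∑ x ∈ A, ∑ y ∈ A, c x y * (f x - f y) ^ 2 := by
  classical
  have h1 : ∀ x y, f x * f y * T x y = (if x = y then f x ^ 2 * T x x else 0) -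
      f x * f y * c x y := by
    intro x y
    split_ifs with h
    · subst h; rw [hdiag]; ring
    · rw [hT x y h]; ring
  have h2 : ∑ x ∈ A, ∑ y ∈ A, c x y * (f x - f y) ^ 2 =
      2 * ∑ x ∈ A, ∑ y ∈ A, f x ^ 2 * c x y - 2 * ∑ x ∈ A, ∑ y ∈ A, f x * f y * c x y := by
    have h3 : ∑ x ∈ A, ∑ y ∈ A, f y ^ 2 * c x y = ∑ x ∈ A, ∑ y ∈ A, f x ^ 2 * c x y := by
      rw [Finset.sum_comm]
      simp only [hsymm]
    rw [two_mul (∑ x ∈ A, ∑ y ∈ A, f x ^ 2 * c x y)]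
    nth_rewrite 2 [← h3]
    simp only [Finset.mul_sum, ← Finset.sum_add_distrib, ← Finset.sum_sub_distrib]
    exact Finset.sum_congr rfl fun x _ => Finset.sum_congr rfl fun y _ => by ring
  rw [h2]
  simp only [h1, Finset.sum_sub_distrib, mul_sub, Finset.mul_sum]
  have h4 : ∑ x ∈ A, ∑ y ∈ A, (if x = y then f x ^ 2 * T x x else 0) =
      ∑ x ∈ A, f x ^ 2 * T x x := by
    refine Finset.sum_congr rfl fun x hx => ?_
    rw [Finset.sum_ite_eq, if_pos hx]
  rw [h4]
  simp only [← mul_assoc]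
  norm_num

/-- The energy, with respect to fused conductances, of a function that vanishes at the fused
vertex. -/
noncomputable def fusedEnergy {X : Type u} {A : Set X} [Fintype A] (C : Option A → Option A → ℝ)
    (f : X → ℝ) : ℝ :=
  2⁻¹ * ∑ i, ∑ j, C i j * (i.elim 0 (fun x => f x) - j.elim 0 (fun x => f x)) ^ 2

/-- Edges to the fused vertex, where the function is 0, act as a mass term; each is counted in both
directions, which cancels the factor one half. -/
theorem fusedEnergy_fusedCond {X : Type u} (c : X → X → ℝ) (A : Set X) [Fintype A] (f : X → ℝ) :
    fusedEnergy (fusedCond c A) f =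
      ∑ x ∈ A.toFinset, f x ^ 2 * (∑' y : (Aᶜ : Set X), c x y) +
        2⁻¹ * ∑ x ∈ A.toFinset, ∑ y ∈ A.toFinset, c x y * (f x - f y) ^ 2 := by
  simp only [← Finset.sum_set_coe, fusedEnergy, Fintype.sum_option, fusedCond, Option.elim,
    Finset.sum_add_distrib]
  simp only [sub_self, sub_zero, zero_sub, neg_sq, mul_comm (f _ ^ 2)]
  ring

theorem tendsto_fusedEnergy {X : Type u} {A : Set X} [Fintype A] {ι : Type*} {l : Filter ι}
    {C : ι → Option A → Option A → ℝ} {C' : Option A → Option A → ℝ}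
    (h : ∀ x y, Tendsto (fun i => C i x y) l (𝓝 (C' x y))) (f : X → ℝ) :
    Tendsto (fun i => fusedEnergy (C i) f) l (𝓝 (fusedEnergy C' f)) :=
  (tendsto_finsetSum _ fun x _ => tendsto_finsetSum _ fun y _ =>
    (h x y).mul_const _).const_mul _

namespace ElectricalNetwork

variable {V : Type u} (G : ElectricalNetwork V)

/-! ### Cutoff functions -/

/-- Finitely supported functions that tend to `1` pointwise and in energy. -/
def HasCutoffs : Prop :=
  ∃ ψ : ℕ → G.dom, (∀ k, (Function.support (ψ k).1).Finite) ∧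
    (∀ k x, (ψ k).1 x ∈ Icc (0 : ℝ) 1) ∧ (∀ x, Tendsto (fun k => (ψ k).1 x) atTop (𝓝 1)) ∧
    Tendsto (fun k => G.bil (ψ k) (ψ k)) atTop (𝓝 0)

theorem sq_one_sub_le {f : V → ℝ} {ρ : V} {ε : ℝ} (hε : 0 ≤ ε) (hρ : f ρ = 1)
    (hf : G.energy f ≤ ENNReal.ofReal ε) (x : V) : (1 - f x) ^ 2 ≤ G.res ρ x * ε := by
  have h1 := G.sq_le_res_mul (hf.trans_lt ENNReal.ofReal_lt_top) ρ x
  rw [hρ] at h1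
  exact h1.trans (mul_le_mul_of_nonneg_left (ENNReal.toReal_le_of_le_ofReal hε hf)
    (G.res_nonneg _ _))

/-- A function equal to 1 at `ρ` with energy `ε` differs from 1 at `x` by at most the square root of
`R(ρ,x) ε`, so pointwise convergence comes for free. -/
theorem hasCutoffs_of (ρ : V) (h : ∀ ε > 0, ∃ f : V → ℝ, (Function.support f).Finite ∧ f ρ = 1 ∧
    G.energy f ≤ ENNReal.ofReal ε) : G.HasCutoffs := by
  have h' : ∀ k : ℕ, ∃ f : V → ℝ, (Function.support f).Finite ∧ f ρ = 1 ∧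
    G.energy f ≤ ENNReal.ofReal (1 / ((k : ℝ) + 1)) := fun k => h _ (by positivity)
  choose f hsupp hρ hE using h'
  set ψ : ℕ → V → ℝ := fun k x => max (min (f k x) 1) 0 with hψ
  have hψE : ∀ k, G.energy (ψ k) ≤ ENNReal.ofReal (1 / ((k : ℝ) + 1)) := fun k =>
    (G.energy_clamp_le _ _ _).trans (hE k)
  have hlim : Tendsto (fun k : ℕ => 1 / ((k : ℝ) + 1)) atTop (𝓝 0) :=
    tendsto_one_div_add_atTop_nhds_zero_nat
  refine ⟨fun k => ⟨ψ k, (hψE k).trans_lt ENNReal.ofReal_lt_top⟩, fun k => ?_, fun k x => ?_,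
    fun x => ?_, ?_⟩
  · refine (hsupp k).subset fun x hx hx0 => hx ?_
    simp [hψ, hx0]
  · exact ⟨le_max_right _ _, max_le (min_le_right _ _) zero_le_one⟩
  · have h1 : Tendsto (fun k => (1 - ψ k x) ^ 2) atTop (𝓝 0) := by
      refine squeeze_zero (fun _ => sq_nonneg _) (fun k => G.sq_one_sub_le (ρ := ρ) (by positivity)
        (by simp [hψ, hρ]) (hψE k) x) ?_
      simpa using hlim.const_mul (G.res ρ x)
    have h2 : Tendsto (fun k => |1 - ψ k x|) atTop (𝓝 0) := by
      have := h1.sqrt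
      simpa [Real.sqrt_sq_eq_abs] using this
    have h3 := (tendsto_zero_iff_abs_tendsto_zero _).2 h2
    simpa using h3.const_sub 1
  · refine squeeze_zero (fun _ => G.bil_self_nonneg _) (fun k => ?_) hlim
    rw [← G.toReal_energy_coe]
    exact ENNReal.toReal_le_of_le_ofReal (by positivity) (hψE k)

/-- Leibniz rule along each edge followed by `(s + t)² ≤ (1 + ε) s² + (1 + ε⁻¹) t²`. The free `ε`
matters: with cutoffs `ψ` of vanishing energy the constant in front of the energy of `v` can be
brought down to 1. -/
theorem exists_mul (v ψ : G.dom) (hv : ∀ x, v.1 x ∈ Icc (0 : ℝ) 1)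
    (hψ : ∀ x, ψ.1 x ∈ Icc (0 : ℝ) 1) :
    ∃ h : (fun x => v.1 x * ψ.1 x) ∈ G.dom, ∀ ε > 0,
      G.bil ⟨_, h⟩ ⟨_, h⟩ ≤ (1 + ε) * G.bil v v + (1 + ε⁻¹) * G.bil ψ ψ := by
  have key : ∀ ε > 0, G.energy (fun x => v.1 x * ψ.1 x) ≤
      ENNReal.ofReal ((1 + ε) * G.bil v v + (1 + ε⁻¹) * G.bil ψ ψ) := by
    intro ε hε
    rw [ENNReal.ofReal_add (mul_nonneg (by positivity) (G.bil_self_nonneg v))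
      (mul_nonneg (by positivity) (G.bil_self_nonneg ψ)), ENNReal.ofReal_mul (by positivity),
      ENNReal.ofReal_mul (by positivity), ← G.energy_coe, ← G.energy_coe]
    simp only [energy_eq_tsum]
    rw [← ENNReal.tsum_mul_left, ← ENNReal.tsum_mul_left, ← ENNReal.tsum_add]
    refine ENNReal.tsum_le_tsum fun p => ?_
    rw [mul_left_comm, mul_left_comm (ENNReal.ofReal (1 + ε⁻¹)), ← mul_add]
    refine mul_le_mul_right ?_ _
    rw [← ENNReal.ofReal_mul (by positivity), ← ENNReal.ofReal_mul (by positivity),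
      ← ENNReal.ofReal_add (mul_nonneg (by positivity) (G.edgeTerm_self_nonneg _ _))
        (mul_nonneg (by positivity) (G.edgeTerm_self_nonneg _ _))]
    apply ENNReal.ofReal_le_ofReal
    simp only [edgeTerm, mul_assoc]
    rw [mul_left_comm (1 + ε), mul_left_comm (1 + ε⁻¹), ← mul_add]
    refine mul_le_mul_of_nonneg_left ?_ (NNReal.coe_nonneg _)
    obtain ⟨ha0, ha1⟩ := hv p.2
    obtain ⟨hb0, hb1⟩ := hψ p.1
    set a := v.1 p.2
    set b := ψ.1 p.1
    set s := v.1 p.1 - a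
    set t := b - ψ.1 p.2
    have e : v.1 p.1 * b - a * ψ.1 p.2 = b * s + a * t := by simp only [s, t]; ring
    rw [e]
    have h1 : 2 * ((b * s) * (a * t)) ≤ ε * (b * s) ^ 2 + ε⁻¹ * (a * t) ^ 2 := by
      have h2 : 0 ≤ ε⁻¹ * (ε * (b * s) - a * t) ^ 2 := by positivity
      have h3 : ε⁻¹ * (ε * (b * s) - a * t) ^ 2 =
          ε * (b * s) ^ 2 + ε⁻¹ * (a * t) ^ 2 - 2 * ((b * s) * (a * t)) := by
        field_simp
        ring
      linarith
    have hbs : (b * s) ^ 2 ≤ s ^ 2 := by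
      rw [mul_pow]
      exact mul_le_of_le_one_left (sq_nonneg _) (pow_le_one₀ hb0 hb1)
    have hat : (a * t) ^ 2 ≤ t ^ 2 := by
      rw [mul_pow]
      exact mul_le_of_le_one_left (sq_nonneg _) (pow_le_one₀ ha0 ha1)
    have h4 : (1 + ε) * (b * s) ^ 2 ≤ (1 + ε) * s ^ 2 :=
      mul_le_mul_of_nonneg_left hbs (by positivity)
    have h5 : (1 + ε⁻¹) * (a * t) ^ 2 ≤ (1 + ε⁻¹) * t ^ 2 :=
      mul_le_mul_of_nonneg_left hat (by positivity)
    linarith [h1, h4, h5, sq s, sq t, sq (b * s), sq (a * t),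
      show (b * s + a * t) * (b * s + a * t) =
        (b * s) ^ 2 + (a * t) ^ 2 + 2 * ((b * s) * (a * t)) by ring]
  have hmem : (fun x => v.1 x * ψ.1 x) ∈ G.dom := (key 1 one_pos).trans_lt ENNReal.ofReal_lt_top
  refine ⟨hmem, fun ε hε => ?_⟩
  rw [← G.toReal_energy_coe]
  refine ENNReal.toReal_le_of_le_ofReal ?_ (key ε hε)
  have h1 := G.bil_self_nonneg v
  have h2 := G.bil_self_nonneg ψ
  positivity

/-! ### Traces -/

theorem harmExt_spec (B : Set V) (x : V) :
    (∀ z ∈ B, G.harmExt B (Set.indicator {x} 1) z = Set.indicator {x} (1 : V → ℝ) z) ∧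
    G.energy (G.harmExt B (Set.indicator {x} 1)) < ⊤ ∧
    ∀ v : V → ℝ, (∀ z ∈ B, v z = Set.indicator {x} (1 : V → ℝ) z) →
      G.energy (G.harmExt B (Set.indicator {x} 1)) ≤ G.energy v := by
  classical
  obtain ⟨f, hf, -, hmin⟩ := G.exists_energy_minimizer B (Set.indicator {x} 1)
    (zero_le_one (α := ℝ)) (fun z _ => by
      by_cases h : z = x <;> simp [h])
  exact Classical.epsilon_spec (p := fun h : V → ℝ => (∀ z ∈ B, h z = Set.indicator {x} 1 z) ∧
    G.energy h < ⊤ ∧ ∀ v : V → ℝ, (∀ z ∈ B, v z = Set.indicator {x} 1 z) →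
      G.energy h ≤ G.energy v)
    ⟨f, hf, (hmin _ fun _ _ => rfl).trans_lt (G.energy_indicator_lt_top x), hmin⟩

variable {X : Type u} (ι : X → V)

/-- The harmonic extension from the range of `ι` of the indicator function of `ι x`. -/
noncomputable def harm (x : X) : G.dom :=
  ⟨G.harmExt (range ι) (Set.indicator {ι x} 1), (G.harmExt_spec _ _).2.1⟩

theorem harm_apply (x y : X) : (G.harm ι x).1 (ι y) = Set.indicator {ι x} 1 (ι y) :=
  (G.harmExt_spec (range ι) (ι x)).1 (ι y) (mem_range_self y)

theorem energy_harm_le (x : X) (v : V → ℝ)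
    (hv : ∀ y, v (ι y) = Set.indicator {ι x} (1 : V → ℝ) (ι y)) :
    G.energy (G.harm ι x) ≤ G.energy v :=
  (G.harmExt_spec (range ι) (ι x)).2.2 v (by rintro _ ⟨y, rfl⟩; exact hv y)

theorem harm_self (x : X) : (G.harm ι x).1 (ι x) = 1 := by
  rw [harm_apply]
  simp

theorem bil_harm_eq_zero (x : X) (w : G.dom) (hw : ∀ y, w.1 (ι y) = 0) :
    G.bil (G.harm ι x) w = 0 := by
  refine G.bil_eq_zero_of_minimal (B := range ι) (G.harm ι x)
    (fun v hv => G.energy_harm_le ι x v fun y => ?_) w ?_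
  · rw [hv _ (mem_range_self y), harm_apply]
  · rintro _ ⟨y, rfl⟩
    exact hw y

/-- The conductances of the trace onto the range of `ι`. -/
noncomputable def traceAlong (x y : X) : ℝ := G.traceCond (range ι) (ι x) (ι y)

theorem traceAlong_self (x : X) : G.traceAlong ι x x = 0 := by simp [traceAlong, traceCond]

theorem traceAlong_symm (x y : X) : G.traceAlong ι x y = G.traceAlong ι y x := by
  classical
  rcases eq_or_ne (ι x) (ι y) with h | h
  · rw [traceAlong, traceAlong, traceCond, traceCond, if_pos h, if_pos h.symm]
  · rw [traceAlong, traceAlong, traceCond, traceCond, if_neg h, if_neg h.symm, G.form_comm]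

variable {ι}

theorem harm_of_ne (hι : Function.Injective ι) {x y : X} (hxy : x ≠ y) :
    (G.harm ι x).1 (ι y) = 0 := by
  rw [harm_apply, Set.indicator_of_notMem (by simpa using fun h => hxy (hι h).symm)]

theorem bil_harm_of_ne (hι : Function.Injective ι) {x y : X} (hxy : x ≠ y) :
    G.bil (G.harm ι x) (G.harm ι y) = -G.traceAlong ι x y := by
  rw [traceAlong, traceCond, if_neg (hι.ne hxy), neg_neg]
  rfl

theorem sum_harm_apply (hι : Function.Injective ι) (A : Finset X) (f : X → ℝ)
    (hf : ∀ x, x ∉ A → f x = 0) (y : X) :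
    (∑ x ∈ A, f x • G.harm ι x : G.dom).1 (ι y) = f y := by
  classical
  simp only [AddSubmonoidClass.coe_finsetSum, Finset.sum_apply, Submodule.coe_smul,
    Pi.smul_apply, smul_eq_mul]
  rw [Finset.sum_eq_single y]
  · rw [G.harm_self, mul_one]
  · intro x _ hxy
    rw [G.harm_of_ne hι hxy, mul_zero]
  · intro hy
    rw [hf y hy, zero_mul]

/-- Subtracting from `w` the combination of harmonic extensions with the same values on the range
leaves a function vanishing there, which is orthogonal to every harmonic extension. -/
theorem bil_harm_eq_sum (hι : Function.Injective ι) (x : X) (A : Finset X) (w : G.dom)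
    (hw : ∀ y, y ∉ A → w.1 (ι y) = 0) :
    G.bil (G.harm ι x) w = ∑ y ∈ A, w.1 (ι y) * G.bil (G.harm ι x) (G.harm ι y) := by
  have h1 := G.bil_harm_eq_zero ι x (w - ∑ y ∈ A, w.1 (ι y) • G.harm ι y) (fun y => by
    rw [Submodule.coe_sub, Pi.sub_apply,
      G.sum_harm_apply hι A (fun y => w.1 (ι y)) hw, sub_self])
  rw [map_sub, sub_eq_zero] at h1
  rw [h1]
  simp

/-- The positive part of `h_x - t h_y` still equals the indicator of `x` on the range, so its energy
is at least that of `h_x`. Expanding in small `t > 0` gives `E(h_x, h_y) ≤ 0`. -/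
theorem traceAlong_nonneg (hι : Function.Injective ι) (x y : X) : 0 ≤ G.traceAlong ι x y := by
  rcases eq_or_ne x y with rfl | hxy
  · rw [traceAlong_self]
  have key : ∀ t : ℝ, 0 < t → 0 ≤ 2 * G.traceAlong ι x y + t * G.bil (G.harm ι y) (G.harm ι y) := by
    intro t ht
    set w : G.dom := G.harm ι x + (-t) • G.harm ι y with hw
    have h4 : G.energy (G.harm ι x) ≤ G.energy (fun z => max (w.1 z) 0) := by
      refine G.energy_harm_le ι x _ fun z => ?_
      have : w.1 (ι z) = (G.harm ι x).1 (ι z) - t * (G.harm ι y).1 (ι z) := by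
        simp [hw, sub_eq_add_neg]
      rw [this]
      rcases eq_or_ne x z with rfl | hxz
      · rw [G.harm_self, G.harm_of_ne hι hxy.symm]; simp
      · rw [G.harm_of_ne hι hxz, Set.indicator_of_notMem (by simpa using fun h => hxz (hι h).symm)]
        rcases eq_or_ne y z with rfl | hyz
        · rw [G.harm_self]; simp [ht.le]
        · rw [G.harm_of_ne hι hyz]; simp
    have h5 : G.energy (fun z => max (w.1 z) 0) ≤ G.energy w :=
      G.energy_lipschitz_le fun a b => abs_max_sub_max_le_abs _ _ _
    have h6 := h4.trans h5
    rw [G.energy_coe, G.energy_coe, ENNReal.ofReal_le_ofReal_iff (G.bil_self_nonneg _), hw,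
      G.bil_add_smul, G.bil_harm_of_ne hι hxy] at h6
    nlinarith
  by_contra hneg
  rw [not_le] at hneg
  have hT := G.bil_self_nonneg (G.harm ι y)
  -- This `t` is small enough that the quadratic term cannot outweigh half of the negative linear
  -- one.
  have := key (-G.traceAlong ι x y / (G.bil (G.harm ι y) (G.harm ι y) + 1))
    (div_pos (by linarith) (by linarith))
  rw [div_mul_eq_mul_div] at this
  have h7 : -G.traceAlong ι x y * G.bil (G.harm ι y) (G.harm ι y) /
      (G.bil (G.harm ι y) (G.harm ι y) + 1) ≤ -G.traceAlong ι x y := by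
    rw [div_le_iff₀ (by linarith)]
    nlinarith
  linarith

/-- Pair `h_x` with cutoffs `ψ k`. By Cauchy–Schwarz the pairing tends to 0, and by finite support
it is the finite sum `ψ_k(x) E(h_x, h_x) - ∑ ψ_k(y) c(x,y)`. Since `0 ≤ ψ_k ≤ 1` and `ψ_k → 1`, both
inequalities follow. Without recurrence, mass could escape to infinity and only `≤` would be
expected. -/
theorem hasSum_traceAlong (hG : G.HasCutoffs) (hι : Function.Injective ι) (x : X) :
    HasSum (G.traceAlong ι x) (G.bil (G.harm ι x) (G.harm ι x)) := by
  classical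
  obtain ⟨ψ, hsupp, hI, hlim, hE⟩ := hG
  set T := G.bil (G.harm ι x) (G.harm ι x) with hT
  have hfin : ∀ k, {y : X | (ψ k).1 (ι y) ≠ 0}.Finite := fun k =>
    (hsupp k).preimage (hι.injOn)
  have hform : ∀ k, ∑ y ∈ (hfin k).toFinset, (ψ k).1 (ι y) * G.traceAlong ι x y =
      (ψ k).1 (ι x) * T - G.bil (G.harm ι x) (ψ k) := by
    intro k
    rw [G.bil_harm_eq_sum hι x (insert x (hfin k).toFinset) (ψ k) (fun y hy => by
      by_contra h; exact hy (by simp [h]))]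
    have h1 : ∑ y ∈ (hfin k).toFinset, (ψ k).1 (ι y) * G.traceAlong ι x y =
        ∑ y ∈ insert x (hfin k).toFinset, (ψ k).1 (ι y) * G.traceAlong ι x y := by
      refine Finset.sum_subset (Finset.subset_insert _ _) fun y hy hy' => ?_
      simp only [Finite.mem_toFinset, mem_ofPred_eq, not_not] at hy'
      rw [hy', zero_mul]
    rw [h1, eq_sub_iff_add_eq, ← Finset.sum_add_distrib,
      Finset.sum_eq_single_of_mem x (Finset.mem_insert_self _ _)]
    · rw [traceAlong_self]; ring
    · intro y _ hyx
      rw [G.bil_harm_of_ne hι hyx.symm]; ring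
  have hb : Tendsto (fun k => G.bil (G.harm ι x) (ψ k)) atTop (𝓝 0) := by
    have h1 : Tendsto (fun k => (G.bil (G.harm ι x) (ψ k)) ^ 2) atTop (𝓝 0) := by
      refine squeeze_zero (fun _ => sq_nonneg _) (fun k => G.bil_sq_le _ _) ?_
      simpa using hE.const_mul T
    have h2 := h1.sqrt
    simp only [Real.sqrt_sq_eq_abs, Real.sqrt_zero] at h2
    exact (tendsto_zero_iff_abs_tendsto_zero _).2 h2
  have hlimT : Tendsto (fun k => (ψ k).1 (ι x) * T - G.bil (G.harm ι x) (ψ k)) atTop (𝓝 T) := by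
    simpa using ((hlim (ι x)).mul_const T).sub hb
  have hnn := G.traceAlong_nonneg hι x
  have hpart : ∀ A : Finset X, ∑ y ∈ A, G.traceAlong ι x y ≤ T := by
    intro A
    have h1 : Tendsto (fun k => ∑ y ∈ A, (ψ k).1 (ι y) * G.traceAlong ι x y) atTop
        (𝓝 (∑ y ∈ A, 1 * G.traceAlong ι x y)) :=
      tendsto_finsetSum _ fun y _ => (hlim (ι y)).mul_const _
    simp only [one_mul] at h1
    refine le_of_tendsto_of_tendsto' h1 hlimT fun k => ?_
    rw [← hform k]
    have h2 : ∑ y ∈ (hfin k).toFinset, (ψ k).1 (ι y) * G.traceAlong ι x y =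
        ∑ y ∈ A ∪ (hfin k).toFinset, (ψ k).1 (ι y) * G.traceAlong ι x y := by
      refine Finset.sum_subset Finset.subset_union_right fun y hy hy' => ?_
      simp only [Finite.mem_toFinset, mem_ofPred_eq, not_not] at hy'
      rw [hy', zero_mul]
    rw [h2]
    exact Finset.sum_le_sum_of_subset_of_nonneg Finset.subset_union_left
      fun y _ _ => mul_nonneg (hI k _).1 (hnn y)
  have hsum : Summable (G.traceAlong ι x) := summable_of_sum_le hnn hpart
  refine hsum.hasSum_iff.2 (le_antisymm (hsum.tsum_le_of_sum_le hpart) ?_)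
  refine le_of_tendsto' hlimT fun k => ?_
  rw [← hform k]
  refine (Finset.sum_le_sum fun y _ => mul_le_of_le_one_left (hnn y) (hI k _).2).trans ?_
  exact hsum.sum_le_tsum _ fun y _ => hnn y

theorem bil_sum_harm (hι : Function.Injective ι) (A : Finset X) (f : X → ℝ) :
    G.bil (∑ x ∈ A, f x • G.harm ι x) (∑ x ∈ A, f x • G.harm ι x) =
      ∑ x ∈ A, f x ^ 2 * (G.bil (G.harm ι x) (G.harm ι x) - ∑ y ∈ A, G.traceAlong ι x y) +
        2⁻¹ * ∑ x ∈ A, ∑ y ∈ A, G.traceAlong ι x y * (f x - f y) ^ 2 := by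
  rw [← sum_mul_mul_eq A (fun x y => G.bil (G.harm ι x) (G.harm ι y)) (G.traceAlong ι)
    (G.traceAlong_symm ι) (G.traceAlong_self ι) (fun x y h => G.bil_harm_of_ne hι h) f]
  simp only [map_sum, map_smul, LinearMap.sum_apply, LinearMap.smul_apply, smul_eq_mul,
    Finset.mul_sum]
  rw [Finset.sum_comm]
  exact Finset.sum_congr rfl fun x _ => Finset.sum_congr rfl fun y _ => by ring

/-- As no mass is lost, the diagonal entry minus the conductance into `A` is exactly the conductance
out of `A`, that is, to the fused vertex. -/
theorem bil_sum_harm_eq_fusedEnergy (hG : G.HasCutoffs) (hι : Function.Injective ι) (A : Set X)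
    [Fintype A] (f : X → ℝ) :
    G.bil (∑ x ∈ A.toFinset, f x • G.harm ι x) (∑ x ∈ A.toFinset, f x • G.harm ι x) =
      fusedEnergy (fusedCond (G.traceAlong ι) A) f := by
  rw [G.bil_sum_harm hι, fusedEnergy_fusedCond]
  congr 1
  refine Finset.sum_congr rfl fun x _ => ?_
  have hs := G.hasSum_traceAlong hG hι x
  rw [← hs.tsum_eq, ← hs.summable.tsum_subtype_add_tsum_subtype_compl A, tsum_fintype,
    Finset.sum_set_coe (f := G.traceAlong ι x), add_sub_cancel_left]

/-- Replacing `w` by the harmonic extension of its values on the range is an orthogonal projection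
and lowers the energy; the mass term of the result is nonnegative and may be dropped. -/
theorem sum_traceAlong_le_of_finite (hG : G.HasCutoffs) (hι : Function.Injective ι) (A : Finset X)
    (w : G.dom) (hw : (Function.support w.1).Finite) :
    2⁻¹ * ∑ x ∈ A, ∑ y ∈ A, G.traceAlong ι x y * (w.1 (ι x) - w.1 (ι y)) ^ 2 ≤ G.bil w w := by
  classical
  have hfin : {y : X | w.1 (ι y) ≠ 0}.Finite := hw.preimage hι.injOn
  set A' := A ∪ hfin.toFinset
  have hA' : ∀ y, y ∉ A' → w.1 (ι y) = 0 := fun y hy => by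
    by_contra h; exact hy (by simp [A', h])
  set H : G.dom := ∑ x ∈ A', w.1 (ι x) • G.harm ι x with hH
  have horth : G.bil H (w - H) = 0 := by
    have h1 : ∀ x, G.bil (G.harm ι x) (w - H) = 0 := fun x =>
      G.bil_harm_eq_zero ι x _ fun y => by
        rw [Submodule.coe_sub, Pi.sub_apply, hH,
          G.sum_harm_apply hι A' (fun y => w.1 (ι y)) hA', sub_self]
    rw [hH]
    simp only [map_sum, map_smul, LinearMap.sum_apply, LinearMap.smul_apply]
    exact Finset.sum_eq_zero fun x _ => by rw [← hH, h1, smul_zero]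
  have hle : G.bil H H ≤ G.bil w w := by
    have h1 := G.bil_add_smul H (w - H) 1
    rw [one_smul, add_sub_cancel, horth] at h1
    have h2 := G.bil_self_nonneg (w - H)
    linarith
  refine le_trans ?_ hle
  rw [hH, G.bil_sum_harm hι]
  have hnn := G.traceAlong_nonneg hι
  have h1 : 0 ≤ ∑ x ∈ A', w.1 (ι x) ^ 2 *
      (G.bil (G.harm ι x) (G.harm ι x) - ∑ y ∈ A', G.traceAlong ι x y) := by
    refine Finset.sum_nonneg fun x _ => mul_nonneg (sq_nonneg _) (sub_nonneg.2 ?_)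
    exact sum_le_hasSum _ (fun y _ => hnn x y) (G.hasSum_traceAlong hG hι x)
  have h2 : ∑ x ∈ A, ∑ y ∈ A, G.traceAlong ι x y * (w.1 (ι x) - w.1 (ι y)) ^ 2 ≤
      ∑ x ∈ A', ∑ y ∈ A', G.traceAlong ι x y * (w.1 (ι x) - w.1 (ι y)) ^ 2 := by
    have hsub : A ⊆ A' := Finset.subset_union_left
    refine (Finset.sum_le_sum fun x _ => Finset.sum_le_sum_of_subset_of_nonneg
      hsub fun y _ _ => mul_nonneg (hnn x y) (sq_nonneg _)).trans ?_
    exact Finset.sum_le_sum_of_subset_of_nonneg Finset.subset_union_left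
      fun x _ _ => Finset.sum_nonneg fun y _ => mul_nonneg (hnn x y) (sq_nonneg _)
  linarith

/-- Multiply `v` by cutoffs to reduce to finite support, then let the cutoffs tend to 1 and finally
`ε → 0`. -/
theorem sum_traceAlong_le (hG : G.HasCutoffs) (hι : Function.Injective ι) (A : Finset X)
    (v : G.dom) (hv : ∀ x, v.1 x ∈ Icc (0 : ℝ) 1) :
    2⁻¹ * ∑ x ∈ A, ∑ y ∈ A, G.traceAlong ι x y * (v.1 (ι x) - v.1 (ι y)) ^ 2 ≤ G.bil v v := by
  obtain ⟨ψ, hsupp, hI, hlim, hE⟩ := id hG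
  have hε : ∀ ε > 0, 2⁻¹ * ∑ x ∈ A, ∑ y ∈ A, G.traceAlong ι x y *
      (v.1 (ι x) - v.1 (ι y)) ^ 2 ≤ (1 + ε) * G.bil v v := by
    intro ε hε
    have hl : Tendsto (fun k => 2⁻¹ * ∑ x ∈ A, ∑ y ∈ A, G.traceAlong ι x y *
        (v.1 (ι x) * (ψ k).1 (ι x) - v.1 (ι y) * (ψ k).1 (ι y)) ^ 2) atTop
        (𝓝 (2⁻¹ * ∑ x ∈ A, ∑ y ∈ A, G.traceAlong ι x y *
        (v.1 (ι x) * 1 - v.1 (ι y) * 1) ^ 2)) :=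
      (tendsto_finsetSum _ fun x _ => tendsto_finsetSum _ fun y _ =>
        ((((hlim (ι x)).const_mul _).sub ((hlim (ι y)).const_mul _)).pow 2).const_mul _).const_mul _
    simp only [mul_one] at hl
    have hr : Tendsto (fun k => (1 + ε) * G.bil v v + (1 + ε⁻¹) * G.bil (ψ k) (ψ k)) atTop
        (𝓝 ((1 + ε) * G.bil v v + (1 + ε⁻¹) * 0)) := (hE.const_mul _).const_add _
    rw [mul_zero, add_zero] at hr
    refine le_of_tendsto_of_tendsto' hl hr fun k => ?_
    obtain ⟨hmem, hle⟩ := G.exists_mul v (ψ k) hv (hI k)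
    refine (G.sum_traceAlong_le_of_finite hG hι A ⟨_, hmem⟩ ?_).trans (hle ε hε)
    exact (hsupp k).subset fun x hx hx0 => hx (by simp [hx0])
  have hr : Tendsto (fun ε : ℝ => (1 + ε) * G.bil v v) (𝓝[>] 0) (𝓝 ((1 + 0) * G.bil v v)) :=
    ((tendsto_id.mono_left nhdsWithin_le_nhds).const_add 1).mul_const _
  rw [add_zero, one_mul] at hr
  exact ge_of_tendsto hr (eventually_mem_nhdsWithin.mono fun ε h => hε ε h)

/-- With this, facts about traces apply to the conductances of the network itself. -/
theorem traceAlong_id (x y : V) : G.traceAlong (id : V → V) x y = G.cond x y := by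
  classical
  have hloop : ∀ x, G.cond x x = 0 := fun x => by
    by_contra h
    exact G.graph.irrefl ((G.pos_iff x x).1 (pos_iff_ne_zero.2 h))
  have hh : ∀ z, G.harmExt (range (id : V → V)) (Set.indicator {z} 1) = Set.indicator {z} 1 :=
    fun z => funext fun a => (G.harmExt_spec _ z).1 a ⟨a, rfl⟩
  rcases eq_or_ne x y with rfl | hxy
  · rw [traceAlong_self, hloop]; rfl
  · rw [traceAlong, traceCond, if_neg (by simpa using hxy), hh, hh, id, id, form_eq]
    have hs : ∀ p ∉ ({(x, y), (y, x)} : Finset (V × V)),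
        G.edgeTerm (Set.indicator {x} 1) (Set.indicator {y} 1) p = 0 := by
      rintro ⟨a, b⟩ hp
      simp only [Finset.mem_insert, Finset.mem_singleton, Prod.mk.injEq, not_or, not_and] at hp
      simp only [edgeTerm]
      by_cases hax : a = x <;> by_cases hbx : b = x <;> by_cases hay : a = y <;>
        by_cases hby : b = y <;> simp_all
    rw [tsum_eq_sum hs, Finset.sum_pair (by simp [hxy])]
    simp [edgeTerm, hxy, hxy.symm, G.symm y x]
    ring

/-- The energy of a finitely supported function is determined by fused conductances. -/
theorem energy_eq_fusedEnergy (hG : G.HasCutoffs) (A : Set V) [Fintype A] (f : V → ℝ)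
    (hf : ∀ x, x ∉ A → f x = 0) :
    G.energy f = ENNReal.ofReal (fusedEnergy (fusedCond (fun x y => (G.cond x y : ℝ)) A) f) := by
  have h1 : fusedCond (fun x y => (G.cond x y : ℝ)) A = fusedCond (G.traceAlong (id : V → V)) A := by
    congr 1
    funext x y
    exact (G.traceAlong_id x y).symm
  rw [h1, ← G.bil_sum_harm_eq_fusedEnergy hG Function.injective_id A f, ← G.energy_coe]
  congr 1
  funext y
  exact (G.sum_harm_apply Function.injective_id A.toFinset f (fun x hx => hf x (by simpa using hx))
    y).symm

/-- Functions of finite energy can be approximated by finitely supported ones. -/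
theorem HasCutoffs.exists_finite_support {G : ElectricalNetwork V} (hG : G.HasCutoffs) (f : G.dom)
    (hf : ∀ x, f.1 x ∈ Icc (0 : ℝ) 1) (x : V) {e : ℝ} (he : G.bil f f < e) :
    ∃ g : V → ℝ, (Function.support g).Finite ∧ g x = f.1 x ∧ (∀ z, f.1 z = 0 → g z = 0) ∧
      G.energy g < ENNReal.ofReal e := by
  obtain ⟨ψ, hsupp, hI, hlim, hE⟩ := hG
  obtain ⟨ε, hε, hεe⟩ : ∃ ε > 0, (1 + ε) * G.bil f f < e := by
    have hr : Tendsto (fun ε : ℝ => (1 + ε) * G.bil f f) (𝓝[>] 0) (𝓝 ((1 + 0) * G.bil f f)) :=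
      ((tendsto_id.mono_left nhdsWithin_le_nhds).const_add 1).mul_const _
    rw [add_zero, one_mul] at hr
    obtain ⟨ε, h1, h2⟩ := ((hr.eventually_lt_const he).and eventually_mem_nhdsWithin).exists
    exact ⟨ε, h2, h1⟩
  have hr : Tendsto (fun k => (((ψ k).1 x)⁻¹) ^ 2 * ((1 + ε) * G.bil f f +
      (1 + ε⁻¹) * G.bil (ψ k) (ψ k))) atTop
      (𝓝 ((1⁻¹) ^ 2 * ((1 + ε) * G.bil f f + (1 + ε⁻¹) * 0))) :=
    (((hlim x).inv₀ one_ne_zero).pow 2).mul ((hE.const_mul _).const_add _)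
  rw [inv_one, one_pow, one_mul, mul_zero, add_zero] at hr
  obtain ⟨k, hk, hk0⟩ := ((hr.eventually_lt_const hεe).and
    ((hlim x).eventually_ne one_ne_zero)).exists
  obtain ⟨hmem, hle⟩ := G.exists_mul f (ψ k) hf (hI k)
  -- Dividing by the value of the cutoff at `x` restores the exact value of `f` there.
  set g : G.dom := ((ψ k).1 x)⁻¹ • ⟨_, hmem⟩ with hg
  have hgv : ∀ z, g.1 z = ((ψ k).1 x)⁻¹ * (f.1 z * (ψ k).1 z) := fun z => rfl
  refine ⟨g.1, (hsupp k).subset fun z hz hz0 => hz ?_, ?_, fun z hz => ?_, ?_⟩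
  · rw [hgv, hz0]; simp
  · rw [hgv]; field_simp
  · rw [hgv, hz]; simp
  · rw [G.energy_coe]
    refine (ENNReal.ofReal_lt_ofReal_iff_of_nonneg (G.bil_self_nonneg _)).2 (lt_of_le_of_lt ?_ hk)
    rw [hg, map_smul, map_smul, LinearMap.smul_apply, smul_eq_mul, smul_eq_mul, ← mul_assoc, ← sq]
    exact mul_le_mul_of_nonneg_left (hle ε hε) (sq_nonneg _)

end ElectricalNetwork

/-! ### Gluing metric spaces -/

section Glue

variable {X Y : Type u} [MetricSpace X] [MetricSpace Y] {I : Type*} (a : I → X) (b : I → Y)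
  (w : I → ℝ)

/-- The length of the shortest path from `x` to `y` over the bridges of length `w i` that join `a i`
to `b i`. -/
noncomputable def bridgeDist (x : X) (y : Y) : ℝ := ⨅ i, (dist x (a i) + w i + dist (b i) y)

variable {a b w}

theorem bridgeDist_le (hw : ∀ i, 0 ≤ w i) (x : X) (y : Y) (i : I) :
    bridgeDist a b w x y ≤ dist x (a i) + w i + dist (b i) y :=
  ciInf_le ⟨0, by rintro _ ⟨j, rfl⟩; have := hw j; positivity⟩ i

variable [Nonempty I]

theorem bridgeDist_le_add_left (hw : ∀ i, 0 ≤ w i) (x x' : X) (y : Y) :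
    bridgeDist a b w x y ≤ dist x x' + bridgeDist a b w x' y := by
  rw [← sub_le_iff_le_add']
  refine le_ciInf fun i => ?_
  have h1 := bridgeDist_le (a := a) (b := b) hw x y i
  have h2 := dist_triangle x x' (a i)
  linarith

theorem bridgeDist_le_add_right (hw : ∀ i, 0 ≤ w i) (x : X) (y y' : Y) :
    bridgeDist a b w x y ≤ bridgeDist a b w x y' + dist y' y := by
  rw [← sub_le_iff_le_add]
  refine le_ciInf fun i => ?_
  have h1 := bridgeDist_le (a := a) (b := b) hw x y i
  have h2 := dist_triangle (b i) y' y
  linarith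

/-- Crossing by bridge `i` and returning by bridge `j` is no shortcut, since the distances between
their feet on the two sides differ by at most `w i + w j`. -/
theorem dist_le_bridgeDist_left (hab : ∀ i j, |dist (a i) (a j) - dist (b i) (b j)| ≤ w i + w j)
    (x x' : X) (y : Y) : dist x x' ≤ bridgeDist a b w x y + bridgeDist a b w x' y := by
  refine le_ciInf_add_ciInf fun i j => ?_
  have h1 := (abs_le.1 (hab i j)).2
  have h2 := dist_triangle4 x (a i) (a j) x'
  have h3 := dist_triangle (b i) y (b j)
  rw [dist_comm (a j) x'] at h2
  rw [dist_comm y (b j)] at h3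
  linarith

theorem dist_le_bridgeDist_right (hab : ∀ i j, |dist (a i) (a j) - dist (b i) (b j)| ≤ w i + w j)
    (x : X) (y y' : Y) : dist y y' ≤ bridgeDist a b w x y + bridgeDist a b w x y' := by
  refine le_ciInf_add_ciInf fun i j => ?_
  have h1 := (abs_le.1 (hab i j)).1
  have h2 := dist_triangle4 y (b i) (b j) y'
  have h3 := dist_triangle (a i) x (a j)
  rw [dist_comm y (b i)] at h2
  rw [dist_comm (a i) x] at h3
  linarith

/-- The disjoint union of two metric spaces that are joined by bridges. -/
@[reducible] noncomputable def bridgePseudoMetric (hw : ∀ i, 0 ≤ w i)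
    (hab : ∀ i j, |dist (a i) (a j) - dist (b i) (b j)| ≤ w i + w j) :
    PseudoMetricSpace (X ⊕ Y) where
  dist
    | .inl x, .inl x' => dist x x'
    | .inr y, .inr y' => dist y y'
    | .inl x, .inr y => bridgeDist a b w x y
    | .inr y, .inl x => bridgeDist a b w x y
  dist_self := by rintro (x | y) <;> exact dist_self _
  dist_comm := by rintro (x | y) (x' | y') <;> first | rfl | exact dist_comm _ _
  dist_triangle := by
    rintro (x | y) (x' | y') (x'' | y'')
    · exact dist_triangle _ _ _
    · exact bridgeDist_le_add_left hw _ _ _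
    · exact dist_le_bridgeDist_left hab _ _ _
    · exact bridgeDist_le_add_right hw _ _ _
    · change bridgeDist a b w x'' y ≤ bridgeDist a b w x' y + dist x' x''
      rw [add_comm, dist_comm]
      exact bridgeDist_le_add_left hw _ _ _
    · exact dist_le_bridgeDist_right hab _ _ _
    · change bridgeDist a b w x'' y ≤ dist y y' + bridgeDist a b w x'' y'
      rw [add_comm, dist_comm]
      exact bridgeDist_le_add_right hw _ _ _
    · exact dist_triangle _ _ _

/-- Bridges of length 0 are allowed, so the glued space is only pseudometric and points at distance
0 must be identified. It stays proper because a closed ball is a union of two compact images. -/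
theorem exists_isometric_quotient [ProperSpace X] [ProperSpace Y] {Z : Type u}
    [PseudoMetricSpace Z] (i : X → Z) (j : Y → Z) (hi : ∀ x x', dist (i x) (i x') = dist x x')
    (hj : ∀ y y', dist (j y) (j y') = dist y y') (hij : ∀ z, z ∈ range i ∪ range j) :
    ∃ (M : Type u) (_ : MetricSpace M) (_ : ProperSpace M) (f : X → M) (g : Y → M),
      Isometry f ∧ Isometry g ∧ ∀ x y, dist (f x) (g y) = dist (i x) (j y) := by
  set f : X → SeparationQuotient Z := fun x => SeparationQuotient.mk (i x)
  set g : Y → SeparationQuotient Z := fun y => SeparationQuotient.mk (j y)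
  have hf : Isometry f := Isometry.of_dist_eq fun x x' =>
    (SeparationQuotient.dist_mk _ _).trans (hi x x')
  have hg : Isometry g := Isometry.of_dist_eq fun y y' =>
    (SeparationQuotient.dist_mk _ _).trans (hj y y')
  refine ⟨_, inferInstance, ⟨fun m r => ?_⟩, f, g, hf, hg, fun x y =>
    SeparationQuotient.dist_mk _ _⟩
  have hcomp : ∀ {T : Type u} [MetricSpace T] [ProperSpace T] (h : T → SeparationQuotient Z),
      Isometry h → IsCompact (h '' (h ⁻¹' Metric.closedBall m r)) := fun h hh =>
    (Metric.isCompact_of_isClosed_isBounded (Metric.isClosed_closedBall.preimage hh.continuous)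
      (hh.antilipschitz.isBounded_preimage Metric.isBounded_closedBall)).image hh.continuous
  have : Metric.closedBall m r = f '' (f ⁻¹' Metric.closedBall m r) ∪
      g '' (g ⁻¹' Metric.closedBall m r) := by
    apply Subset.antisymm
    · intro z hz
      obtain ⟨z, rfl⟩ := SeparationQuotient.surjective_mk z
      rcases hij z with ⟨x, rfl⟩ | ⟨y, rfl⟩
      · exact Or.inl ⟨x, hz, rfl⟩
      · exact Or.inr ⟨y, hz, rfl⟩
    · exact union_subset (image_preimage_subset _ _) (image_preimage_subset _ _)
  rw [this]
  exact (hcomp f hf).union (hcomp g hg)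

theorem exists_isometric_gluing [ProperSpace X] [ProperSpace Y] (hw : ∀ i, 0 ≤ w i)
    (hab : ∀ i j, |dist (a i) (a j) - dist (b i) (b j)| ≤ w i + w j) :
    ∃ (M : Type u) (_ : MetricSpace M) (_ : ProperSpace M) (f : X → M) (g : Y → M),
      Isometry f ∧ Isometry g ∧ ∀ i, dist (f (a i)) (g (b i)) ≤ w i := by
  obtain ⟨M, h1, h2, f, g, hf, hg, hfg⟩ := @exists_isometric_quotient X Y _ _ _ _ (X ⊕ Y)
    (bridgePseudoMetric hw hab) Sum.inl Sum.inr (fun _ _ => rfl) (fun _ _ => rfl) (by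
      rintro (x | y)
      · exact Or.inl ⟨x, rfl⟩
      · exact Or.inr ⟨y, rfl⟩)
  refine ⟨M, h1, h2, f, g, hf, hg, fun i => ?_⟩
  refine ((hfg _ _).trans_le (bridgeDist_le hw (a i) (b i) i)).trans ?_
  simp

end Glue

/-! ### A criterion for local Gromov--Hausdorff convergence -/

theorem lintegral_exp_neg_Ioi (c : ℝ) :
    ∫⁻ r in Ioi c, ENNReal.ofReal (Real.exp (-r)) = ENNReal.ofReal (Real.exp (-c)) := by
  rw [← integral_exp_neg_Ioi c, MeasureTheory.ofReal_integral_eq_lintegral_ofReal]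
  · exact integrableOn_exp_neg_Ioi c
  · exact Eventually.of_forall fun x => (Real.exp_pos _).le

/-- The integral is split into good radii, the intervals of length `2 d` around the exceptional
radii in `t`, and the exponential tail beyond `r₀`. -/
theorem localHausdorffDist_le {M : Type u} [MetricSpace M] (o : M) (A B : Set M) {c d r₀ : ℝ}
    (t : Finset ℝ)
    (h : ∀ r, 0 < r → r < r₀ → (∀ s ∈ t, r ∉ Icc (s - d) (s + d)) →
      Metric.hausdorffEDist (A ∩ Metric.ball o r) (B ∩ Metric.ball o r) ≤ ENNReal.ofReal c) :
    localHausdorffDist o A B ≤ ENNReal.ofReal c + t.card * ENNReal.ofReal (2 * d) +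
      ENNReal.ofReal (Real.exp (-r₀)) := by
  have hexp : Measurable fun r : ℝ => ENNReal.ofReal (Real.exp (-r)) := by fun_prop
  have hle : ∀ r ∈ Ioi (0 : ℝ), ENNReal.ofReal (Real.exp (-r)) *
      min 1 (Metric.hausdorffEDist (closure (A ∩ Metric.ball o r))
        (closure (B ∩ Metric.ball o r))) ≤
      (ENNReal.ofReal (Real.exp (-r)) * ENNReal.ofReal c +
        ∑ s ∈ t, (Icc (s - d) (s + d)).indicator 1 r) +
      (Ici r₀).indicator (fun r => ENNReal.ofReal (Real.exp (-r))) r := by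
    intro r hr
    rw [Metric.hausdorffEDist_closure]
    by_cases h1 : r < r₀
    · by_cases h2 : ∀ s ∈ t, r ∉ Icc (s - d) (s + d)
      · refine le_trans ?_ (le_self_add.trans le_self_add)
        gcongr
        exact (min_le_right _ _).trans (h r hr h1 h2)
      · push Not at h2
        obtain ⟨s, hs, hrs⟩ := h2
        refine le_trans ?_ (le_add_self.trans le_self_add)
        refine le_trans ?_ (Finset.single_le_sum
          (f := fun s => (Icc (s - d) (s + d)).indicator (1 : ℝ → ℝ≥0∞) r)
          (fun _ _ => zero_le) hs)
        rw [Set.indicator_of_mem hrs, Pi.one_apply]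
        refine mul_le_one' (ENNReal.ofReal_le_one.2 ?_) (min_le_left _ _)
        exact Real.exp_le_one_iff.2 (neg_nonpos.2 (le_of_lt hr))
    · refine le_trans ?_ le_add_self
      rw [Set.indicator_of_mem (show r ∈ Ici r₀ from not_lt.1 h1)]
      exact mul_le_of_le_one_right' (min_le_left _ _)
  have hm : ∀ s : ℝ, Measurable ((Icc (s - d) (s + d)).indicator (1 : ℝ → ℝ≥0∞)) := fun s =>
    measurable_one.indicator measurableSet_Icc
  have hm' : Measurable fun r : ℝ => ENNReal.ofReal (Real.exp (-r)) * ENNReal.ofReal c +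
      ∑ s ∈ t, (Icc (s - d) (s + d)).indicator (1 : ℝ → ℝ≥0∞) r :=
    (hexp.mul_const _).add (Finset.measurable_fun_sum _ fun s _ => hm s)
  refine (MeasureTheory.setLIntegral_mono' measurableSet_Ioi hle).trans ?_
  rw [MeasureTheory.lintegral_add_left hm',
    MeasureTheory.lintegral_add_left (hexp.mul_const _),
    MeasureTheory.lintegral_mul_const _ hexp, lintegral_exp_neg_Ioi, neg_zero, Real.exp_zero,
    ENNReal.ofReal_one, one_mul, MeasureTheory.lintegral_finsetSum _ fun s _ => hm s]
  gcongr
  · rw [← nsmul_eq_mul]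
    refine Finset.sum_le_card_nsmul _ _ _ fun s _ => ?_
    refine (MeasureTheory.setLIntegral_le_lintegral _ _).trans ?_
    rw [MeasureTheory.lintegral_indicator_one measurableSet_Icc, Real.volume_Icc]
    exact ENNReal.ofReal_le_ofReal (by linarith)
  · refine (MeasureTheory.setLIntegral_le_lintegral _ _).trans ?_
    rw [MeasureTheory.lintegral_indicator measurableSet_Ici,
      MeasureTheory.setLIntegral_congr MeasureTheory.Ioi_ae_eq_Ici.symm, lintegral_exp_neg_Ioi]

/-- Truncation to a ball is unstable only at radii where the ball is about to reach a new part of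
the space. Cover a large ball by finitely many balls of radius `η / 2`; the exceptional radii are
the distances from `o` to these. Away from them, a small ball met at radius `r + d` is already met
at radius `r - d`. -/
theorem exists_exceptional_radii {Y : Type u} [MetricSpace Y] [ProperSpace Y] (o : Y) (r₀ : ℝ)
    {η : ℝ} (hη : 0 < η) :
    ∃ t : Finset ℝ, ∀ d ∈ Ioc (0 : ℝ) 1, ∀ r < r₀, (∀ s ∈ t, r ∉ Icc (s - d) (s + d)) →
      ∀ q, dist q o < r + d → ∃ p, dist p o < r - d ∧ dist q p ≤ η := by
  classical
  obtain ⟨T, -, hT, hcover⟩ :=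
    (isCompact_closedBall o (r₀ + 1)).finite_cover_balls (half_pos hη)
  refine ⟨hT.toFinset.image fun z => Metric.infDist o (Metric.ball z (η / 2)), ?_⟩
  intro d hd r hr ht q hq
  obtain ⟨z, hzT, hqz⟩ := mem_iUnion₂.1 (hcover (show q ∈ Metric.closedBall o (r₀ + 1) by
    rw [Metric.mem_closedBall]; linarith [hd.2]))
  by_contra! hcon
  refine ht _ (Finset.mem_image_of_mem _ (hT.mem_toFinset.2 hzT)) ⟨?_, ?_⟩
  · have := Metric.infDist_le_dist_of_mem (x := o) hqz
    rw [dist_comm] at this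
    linarith
  · have h1 : r - d ≤ Metric.infDist o (Metric.ball z (η / 2)) := by
      refine (Metric.le_infDist ⟨q, hqz⟩).2 fun {p} hp => ?_
      by_contra! hlt
      rw [dist_comm] at hlt
      have h2 := hcon p hlt
      have h3 := dist_triangle_right q p z
      rw [Metric.mem_ball] at hqz hp
      linarith
    linarith

/-- Glue the two spaces along the almost isometric nets, with a bridge of length 0 at the roots. `δ`
and `r₀` depend only on the limit space and `ε`, so the criterion applies to a sequence of spaces
`X`. -/
theorem exists_localGHDist_le {Y : Type u} [MetricSpace Y] [ProperSpace Y] (o : Y) {ε : ℝ≥0∞}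
    (hε : 0 < ε) :
    ∃ δ > 0, ∃ r₀ : ℝ, ∀ (X : Type u) [MetricSpace X] [ProperSpace X] (x₀ : X) (I : Type u)
      (a : I → X) (b : I → Y) (i₀ : I), a i₀ = x₀ → b i₀ = o →
      (∀ i j, |dist (a i) (a j) - dist (b i) (b j)| ≤ δ) →
      (∀ x, dist x x₀ < r₀ → ∃ i, dist x (a i) ≤ δ) →
      (∀ y, dist y o < r₀ → ∃ i, dist y (b i) ≤ δ) → localGHDist X Y x₀ o ≤ ε := by
  obtain ⟨e, he0, heε⟩ := ENNReal.lt_iff_exists_nnreal_btwn.1 hε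
  have he : (0 : ℝ) < e := by exact_mod_cast he0
  obtain ⟨r₀, hr₀⟩ : ∃ r₀ : ℝ, Real.exp (-r₀) ≤ e / 4 :=
    ⟨-Real.log (e / 4), by rw [neg_neg, Real.exp_log (by positivity)]⟩
  obtain ⟨t, ht⟩ := exists_exceptional_radii o r₀ (η := e / 4) (by positivity)
  -- `D` is chosen after the exceptional radii. The Hausdorff error `D + e / 4` is at most `e / 2`;
  -- the exceptional intervals and the tail cost `e / 4` each.
  obtain ⟨D, hD0, hD1, hDe, hDt⟩ : ∃ D : ℝ, 0 < D ∧ D ≤ 1 ∧ D ≤ e / 4 ∧ t.card * (2 * D) ≤ e / 4 := by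
    refine ⟨min (min 1 (e / 4)) (e / (8 * (t.card + 1))), by positivity,
      (min_le_left _ _).trans (min_le_left _ _), (min_le_left _ _).trans (min_le_right _ _), ?_⟩
    have h1 : min (min 1 ((e : ℝ) / 4)) (e / (8 * (t.card + 1))) ≤ e / (8 * (t.card + 1)) :=
      min_le_right _ _
    calc (t.card : ℝ) * (2 * min (min 1 ((e : ℝ) / 4)) (e / (8 * (t.card + 1))))
        ≤ (t.card + 1) * (2 * (e / (8 * (t.card + 1)))) := by
          gcongr
          linarith
      _ = e / 4 := by field_simp; norm_num
  refine ⟨D / 2, by positivity, r₀, ?_⟩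
  intro X _ _ x₀ I a b i₀ ha hb hab hX hY
  have : Nonempty I := ⟨i₀⟩
  classical
  -- Length 0 at the roots forces their images to coincide; any other pair of bridges has total
  -- length at least `D / 2`, the permitted distortion.
  set w : I → ℝ := fun i => if a i = x₀ ∧ b i = o then 0 else D / 2 with hwdef
  have hw : ∀ i, 0 ≤ w i := fun i => by
    simp only [hwdef]; split_ifs <;> positivity
  have hwD : ∀ i, w i ≤ D / 2 := fun i => by
    simp only [hwdef]; split_ifs <;> linarith
  have hw₀ : w i₀ = 0 := if_pos ⟨ha, hb⟩
  have hab' : ∀ i j, |dist (a i) (a j) - dist (b i) (b j)| ≤ w i + w j := by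
    intro i j
    by_cases hi : a i = x₀ ∧ b i = o
    · by_cases hj : a j = x₀ ∧ b j = o
      · rw [hi.1, hi.2, hj.1, hj.2]
        simp [hw i, hw j, add_nonneg]
      · have : w j = D / 2 := if_neg hj
        linarith [hab i j, hw i]
    · have : w i = D / 2 := if_neg hi
      linarith [hab i j, hw j]
  obtain ⟨M, _, _, f, g, hf, hg, hfg⟩ := exists_isometric_gluing hw hab'
  have hroot : f x₀ = g o := by
    have := hfg i₀
    rw [hw₀, ha, hb] at this
    exact dist_le_zero.1 this
  have hXY : ∀ x, dist x x₀ < r₀ → ∃ y, dist (f x) (g y) ≤ D := by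
    intro x hx
    obtain ⟨i, hi⟩ := hX x hx
    refine ⟨b i, (dist_triangle _ (f (a i)) _).trans ?_⟩
    rw [hf.dist_eq]
    linarith [hfg i, hwD i]
  have hYX : ∀ y, dist y o < r₀ → ∃ x, dist (f x) (g y) ≤ D := by
    intro y hy
    obtain ⟨i, hi⟩ := hY y hy
    refine ⟨a i, (dist_triangle _ (g (b i)) _).trans ?_⟩
    rw [hg.dist_eq, dist_comm (b i)]
    linarith [hfg i, hwD i]
  have hmain : localHausdorffDist (g o) (range f) (range g) ≤ ε := by
    refine (localHausdorffDist_le (c := D + e / 4) (d := D) (r₀ := r₀) (g o) _ _ t ?_).trans ?_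
    · intro r hr hrr hrt
      have hreg := ht D ⟨hD0, hD1⟩ r hrr hrt
      apply Metric.hausdorffEDist_le_of_mem_edist
      · rintro _ ⟨⟨x, rfl⟩, hx⟩
        rw [Metric.mem_ball, ← hroot, hf.dist_eq] at hx
        obtain ⟨y, hy⟩ := hXY x (hx.trans hrr)
        have hyo : dist y o < r + D := by
          rw [← hg.dist_eq, ← hroot]
          refine (dist_triangle_left _ _ (f x)).trans_lt ?_
          rw [hf.dist_eq]
          linarith
        obtain ⟨p, hp, hyp⟩ := hreg y hyo
        refine ⟨g p, ⟨mem_range_self p, ?_⟩, ?_⟩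
        · rw [Metric.mem_ball, hg.dist_eq]; linarith
        · rw [edist_dist]
          apply ENNReal.ofReal_le_ofReal
          refine (dist_triangle _ (g y) _).trans ?_
          rw [hg.dist_eq]
          linarith
      · rintro _ ⟨⟨y, rfl⟩, hy⟩
        rw [Metric.mem_ball, hg.dist_eq] at hy
        obtain ⟨p, hp, hyp⟩ := hreg y (by linarith)
        obtain ⟨x, hx⟩ := hYX p (by linarith)
        refine ⟨f x, ⟨mem_range_self x, ?_⟩, ?_⟩
        · rw [Metric.mem_ball]
          refine (dist_triangle _ (g p) _).trans_lt ?_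
          rw [hg.dist_eq]
          linarith
        · rw [edist_dist]
          apply ENNReal.ofReal_le_ofReal
          refine (dist_triangle_right _ _ (g p)).trans ?_
          rw [hg.dist_eq]
          linarith
    · refine le_trans ?_ heε.le
      rw [← ENNReal.ofReal_natCast, ← ENNReal.ofReal_mul (by positivity),
        ← ENNReal.ofReal_add (by positivity) (by positivity),
        ← ENNReal.ofReal_add (by positivity) (by positivity), ← ENNReal.ofReal_coe_nnreal]
      exact ENNReal.ofReal_le_ofReal (by linarith)
  refine (sInf_le ?_).trans hmain
  exact ⟨M, inferInstance, inferInstance, g o, f, g, hf, hg, hroot, rfl, rfl⟩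

/-! ### Effective resistances -/

theorem exists_of_lt_effRes {X : Type u} {E : (X → ℝ) → ℝ≥0∞} {A B : Set X} {L : ℝ≥0∞}
    (h : L < effRes E A B) :
    ∃ f : X → ℝ, (∀ x ∈ A, f x = 1) ∧ (∀ x ∈ B, f x = 0) ∧ E f < L⁻¹ := by
  rw [effRes, ENNReal.lt_inv_iff_lt_inv] at h
  simp only [iInf_lt_iff] at h
  obtain ⟨f, hA, hB, hf⟩ := h
  exact ⟨f, hA, hB, hf⟩

theorem le_effRes {X : Type u} {E : (X → ℝ) → ℝ≥0∞} {A B : Set X} {L : ℝ≥0∞} (f : X → ℝ)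
    (hA : ∀ x ∈ A, f x = 1) (hB : ∀ x ∈ B, f x = 0) (hf : E f ≤ L⁻¹) : L ≤ effRes E A B := by
  rw [effRes, ENNReal.le_inv_iff_le_inv]
  refine le_trans ?_ hf
  exact iInf_le_of_le f (iInf_le_of_le hA (iInf_le_of_le hB le_rfl))

/-! ### Finite balls and cutoffs of recurrent networks -/

namespace ElectricalNetwork

variable {V : Type u} (G : ElectricalNetwork V)

/-- The indicator of `x` has finite energy `E`, so every other vertex is at resistance at least `1 /
E`. Compact balls are therefore finite. -/
instance discreteTopology_space : DiscreteTopology G.Space := by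
  refine discreteTopology_iff_isOpen_singleton.2 fun (x : V) => Metric.isOpen_singleton_iff.2 ?_
  set E := (G.energy (Set.indicator {x} 1)).toReal with hE
  have hE0 : 0 ≤ E := ENNReal.toReal_nonneg
  refine ⟨1 / (E + 1), by positivity, fun (y : V) hy => ?_⟩
  by_contra h0
  have hne : ¬ (y : V) = x := h0
  have h1 := G.sq_le_res_mul (G.energy_indicator_lt_top x) y x
  rw [Set.indicator_of_notMem (show y ∉ ({x} : Set V) from hne),
    Set.indicator_of_mem (mem_singleton x)] at h1
  have h2 : G.res y x < 1 / (E + 1) := hy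
  have h3 : G.res y x * (E + 1) < 1 := by rwa [lt_div_iff₀ (by positivity)] at h2
  have h4 := G.res_nonneg y x
  simp only [Pi.one_apply, zero_sub, even_two, Even.neg_pow, one_pow] at h1
  nlinarith

theorem finite_ball [ProperSpace G.Space] (ρ : V) (r : ℝ) : {y | G.res ρ y < r}.Finite := by
  have h : (Metric.closedBall (α := G.Space) ρ r).Finite :=
    (isCompact_closedBall (α := G.Space) ρ r).finite_of_discrete
  exact h.subset fun (y : V) hy => (G.res_comm y ρ).trans_le (le_of_lt hy)

theorem hasCutoffs_of_isRecurrentAt [ProperSpace G.Space] (ρ : V)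
    (h : IsRecurrentAt G.energy G.res ρ) : G.HasCutoffs := by
  refine G.hasCutoffs_of ρ fun ε hε => ?_
  have hε' : (ENNReal.ofReal ε)⁻¹ < ⊤ := by simpa using hε
  obtain ⟨r, hr⟩ := (h.eventually (lt_mem_nhds hε')).exists
  obtain ⟨f, h1, h2, h3⟩ := exists_of_lt_effRes hr
  rw [inv_inv] at h3
  refine ⟨f, (G.finite_ball ρ r).subset fun x hx => ?_, h1 ρ rfl, h3.le⟩
  by_contra hxr
  exact hx (h2 x hxr)

end ElectricalNetwork

/-! ### Limits along ultrafilters -/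

theorem exists_ultralimit {α β : Type*} (U : Ultrafilter α) (f : α → β → ℝ)
    (hf : ∀ n w, f n w ∈ Icc (0 : ℝ) 1) :
    ∃ v : β → ℝ, (∀ w, v w ∈ Icc (0 : ℝ) 1) ∧ ∀ w, Tendsto (fun n => f n w) U (𝓝 (v w)) := by
  have h : ∀ w, ∃ a ∈ Icc (0 : ℝ) 1, (U.map fun n => f n w : Filter ℝ) ≤ 𝓝 a := fun w =>
    isCompact_Icc.ultrafilter_le_nhds (U.map fun n => f n w)
      (le_principal_iff.2 (mem_map.2 (Eventually.of_forall fun n => hf n w)))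
  choose v hv hlim using h
  exact ⟨v, hv, fun w => hlim w⟩

theorem exists_ultrafilter_of_frequently {p : ℕ → Prop} (h : ∃ᶠ n in atTop, p n) :
    ∃ U : Ultrafilter ℕ, (U : Filter ℕ) ≤ atTop ∧ ∀ᶠ n in (U : Filter ℕ), p n := by
  have : (atTop ⊓ 𝓟 {n | p n}).NeBot := frequently_mem_iff_neBot.1 h
  refine ⟨Ultrafilter.of (atTop ⊓ 𝓟 {n | p n}), (Ultrafilter.of_le _).trans inf_le_left, ?_⟩
  exact (Ultrafilter.of_le _).trans inf_le_right (mem_principal_self _)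

/-! ### Finite pieces of the vertex sets and comparison of the networks -/

namespace ApproxSetting

variable {W : Type u} (S : ApproxSetting W)

theorem exists_mem_K (m : ℕ) (x : S.V m) : ∃ N, x.1 ∈ S.K N :=
  mem_iUnion.1 (S.iUnion_V_subset (mem_iUnion.2 ⟨m, x.2⟩))

theorem exists_subset_K (m : ℕ) (A : Finset (S.V m)) : ∃ N, ∀ x ∈ A, x.1 ∈ S.K N := by
  choose N hN using S.exists_mem_K m
  exact ⟨A.sup N, fun x hx => S.K_mono (Finset.le_sup hx) (hN x)⟩

theorem finite_KV (m N : ℕ) : (S.KV m N).Finite :=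
  ((S.finite_inter m N).preimage Subtype.val_injective.injOn).subset fun x hx => ⟨x.2, hx⟩

theorem traceG_eq {m n : ℕ} (h : m ≤ n) :
    S.traceG n m = (S.G n).traceAlong (Set.inclusion (S.V_mono h)) := by
  funext x y
  rw [traceG, dif_pos h]
  rfl

theorem resG_eq (n : ℕ) (x y : S.V n) :
    S.resG n x.1 y.1 = ENNReal.ofReal ((S.G n).res x y) := by
  rw [resG, dif_pos ⟨x.2, y.2⟩]

/-- A point of `V m` as a point of the union of the vertex sets. -/
def toTot (m : ℕ) (x : S.V m) : S.Vtot := ⟨x.1, mem_iUnion.2 ⟨m, x.2⟩⟩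

theorem resTot_toTot (m : ℕ) (x y : S.V m) : S.resTot (S.toTot m x) (S.toTot m y) = (S.H m).res x y :=
  S.resTot_eq _ _ m x.2 y.2

theorem dist_toTot (m : ℕ) (x y : S.V m) : dist (S.toTot m x) (S.toTot m y) = (S.H m).res x y :=
  S.resTot_toTot m x y

theorem exists_toTot (x : S.Vtot) : ∃ m, ∀ n ≥ m, ∃ y : S.V n, S.toTot n y = x := by
  obtain ⟨m, hm⟩ := S.exists_mem x
  exact ⟨m, fun n hn => ⟨⟨x.1, S.V_mono hn hm⟩, rfl⟩⟩

variable {S}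

namespace Approximation

variable (hS : S.Approximation)
include hS

/-! ### Limits of functions of bounded energy -/

theorem tendsto_traceG (m : ℕ) (x y : S.V m) :
    Tendsto (fun n => S.traceG n m x y) atTop (𝓝 ((S.H m).cond x y)) := by
  classical
  obtain ⟨N, hN⟩ := S.exists_subset_K m {x, y}
  exact hS.conductance m N (some ⟨x, hN x (by simp)⟩) (some ⟨y, hN y (by simp)⟩)

/-- The trace inequality bounds each finite partial sum with trace conductances by the energy on `G
n`; these partial sums converge, and the energy on `H m` is the supremum of the limits. -/
theorem energy_le_of_tendsto (hG : ∀ n, (S.G n).HasCutoffs) {U : Filter ℕ} [U.NeBot]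
    (hU : U ≤ atTop) {f : ℕ → W → ℝ} (hf : ∀ n w, f n w ∈ Icc (0 : ℝ) 1) {v : W → ℝ}
    (hlim : ∀ w, Tendsto (fun n => f n w) U (𝓝 (v w))) {C : ℝ} (hC : 0 ≤ C)
    (hE : ∀ᶠ n in U, (S.G n).energy (fun x => f n x.1) ≤ ENNReal.ofReal C) (m : ℕ) :
    (S.H m).energy (fun x => v x.1) ≤ ENNReal.ofReal C := by
  classical
  have hA : ∀ A : Finset (S.V m), 2⁻¹ * ∑ x ∈ A, ∑ y ∈ A, ((S.H m).cond x y : ℝ) *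
      (v x.1 - v y.1) ^ 2 ≤ C := by
    intro A
    have hl : Tendsto (fun n => 2⁻¹ * ∑ x ∈ A, ∑ y ∈ A, S.traceG n m x y *
        (f n x.1 - f n y.1) ^ 2) U
        (𝓝 (2⁻¹ * ∑ x ∈ A, ∑ y ∈ A, ((S.H m).cond x y : ℝ) * (v x.1 - v y.1) ^ 2)) :=
      (tendsto_finsetSum _ fun x _ => tendsto_finsetSum _ fun y _ =>
        ((hS.tendsto_traceG m x y).mono_left hU).mul
          (((hlim x.1).sub (hlim y.1)).pow 2)).const_mul _
    refine le_of_tendsto hl ?_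
    filter_upwards [hE, hU (eventually_ge_atTop m)] with n hn hmn
    have hmem : (fun x : S.V n => f n x.1) ∈ (S.G n).dom := hn.trans_lt ENNReal.ofReal_lt_top
    have h1 := (S.G n).sum_traceAlong_le (hG n) (Set.inclusion_injective (S.V_mono hmn)) A
      ⟨_, hmem⟩ (fun x => hf n x.1)
    rw [← S.traceG_eq hmn] at h1
    refine h1.trans ?_
    rw [← (S.G n).toReal_energy_coe]
    exact ENNReal.toReal_le_of_le_ofReal hC hn
  rw [(S.H m).energy_eq_tsum, ENNReal.tsum_eq_iSup_sum]
  refine iSup_le fun s => ?_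
  set A := s.image Prod.fst ∪ s.image Prod.snd
  have hsub : s ⊆ A ×ˢ A := fun p hp => Finset.mem_product.2
    ⟨Finset.mem_union_left _ (Finset.mem_image_of_mem _ hp),
      Finset.mem_union_right _ (Finset.mem_image_of_mem _ hp)⟩
  refine (Finset.sum_le_sum_of_subset hsub).trans ?_
  rw [← Finset.mul_sum, ← ENNReal.ofReal_sum_of_nonneg
    (fun p _ => (S.H m).edgeTerm_self_nonneg _ p), Finset.sum_product]
  have h2 : (2⁻¹ : ℝ≥0∞) = ENNReal.ofReal 2⁻¹ := by
    rw [ENNReal.ofReal_inv_of_pos (by norm_num)]; simp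
  rw [h2, ← ENNReal.ofReal_mul (by norm_num)]
  refine ENNReal.ofReal_le_ofReal (le_trans (le_of_eq ?_) (hA A))
  congr 1
  refine Finset.sum_congr rfl fun x _ => Finset.sum_congr rfl fun y _ => ?_
  simp only [ElectricalNetwork.edgeTerm]
  ring

/-- Take harmonic extensions from `V m` to `G n`. Finite support makes the energy a finite sum of
fused conductances, and the conductance to the fused vertex carries the whole contribution from
outside `K N`. -/
theorem exists_recovery (hG : ∀ n, (S.G n).HasCutoffs) {m : ℕ} (hH : (S.H m).HasCutoffs) (N : ℕ)
    (f : W → ℝ) (hf : ∀ w ∈ S.V m, w ∉ S.K N → f w = 0) :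
    ∃ F : ℕ → W → ℝ, (∀ n ≥ m, ∀ w ∈ S.V m, F n w = f w) ∧
      Tendsto (fun n => (S.G n).energy (fun x => F n x.1)) atTop
        (𝓝 ((S.H m).energy fun x => f x.1)) := by
  classical
  let _ : Fintype (S.KV m N) := (S.finite_KV m N).fintype
  have key : ∀ n, ∃ F : W → ℝ, m ≤ n → (∀ w ∈ S.V m, F w = f w) ∧
      (S.G n).energy (fun x => F x.1) =
        ENNReal.ofReal (fusedEnergy (fusedCond (S.traceG n m) (S.KV m N)) fun x => f x.1) := by
    intro n
    by_cases hmn : m ≤ n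
    · have hinj := Set.inclusion_injective (S.V_mono hmn)
      set h : (S.G n).dom := ∑ x ∈ (S.KV m N).toFinset,
        f x.1 • (S.G n).harm (Set.inclusion (S.V_mono hmn)) x with hh
      -- Functions on the various `V n` are extended by 0 to `W`, so that they can be compared on
      -- one set.
      have hF : ∀ x : S.V n, Function.extend Subtype.val h.1 0 x.1 = h.1 x := fun x =>
        Subtype.val_injective.extend_apply _ _ x
      refine ⟨Function.extend Subtype.val h.1 0, fun _ => ⟨fun w hw => ?_, ?_⟩⟩
      · have h1 := (S.G n).sum_harm_apply hinj (S.KV m N).toFinset (fun x => f x.1)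
          (fun x hx => hf x.1 x.2 fun h => hx (Set.mem_toFinset.2 h)) ⟨w, hw⟩
        rw [← h1, ← hh]
        exact hF ⟨w, S.V_mono hmn hw⟩
      · simp only [hF]
        rw [(S.G n).energy_coe, hh,
          (S.G n).bil_sum_harm_eq_fusedEnergy (hG n) hinj (S.KV m N) fun x => f x.1,
          S.traceG_eq hmn]
    · exact ⟨0, fun h => absurd h hmn⟩
  choose F hF using key
  refine ⟨F, fun n hn => (hF n hn).1, ?_⟩
  rw [(S.H m).energy_eq_fusedEnergy hH (S.KV m N) (fun x => f x.1)
    (fun x hx => hf x.1 x.2 hx)]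
  refine Tendsto.congr' ?_ ((ENNReal.continuous_ofReal.tendsto _).comp
    (tendsto_fusedEnergy (hS.conductance m N) fun x => f x.1))
  filter_upwards [eventually_ge_atTop m] with n hn
  exact (hF n hn).2.symm

/-! ### Neighbourhood maps -/

theorem exists_neighbourhood_map {δ : ℝ} (hδ : 0 < δ) :
    ∃ (m : ℕ) (g : S.Vtot → S.V m), (∀ N (x : S.Vtot), x.1 ∈ S.K N → (g x).1 ∈ S.K N) ∧
      (∀ N (x : S.Vtot), x.1 ∉ S.K N → (g x).1 ∉ S.K N) ∧
      (∀ᶠ n in atTop, ∀ (h : m ≤ n) (x : S.V n), (S.G n).res x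
        (Set.inclusion (S.V_mono h) (g (S.toTot n x))) ≤ δ) ∧
      ∀ x : S.Vtot, dist x (S.toTot m (g x)) ≤ δ := by
  obtain ⟨g, h1, h2, h3, h4⟩ := hS.neighbourhood
  have hδ' : 0 < ENNReal.ofReal δ := ENNReal.ofReal_pos.2 hδ
  obtain ⟨m, hm3, hm4⟩ := ((h3.eventually (gt_mem_nhds hδ')).and
    (h4.eventually (gt_mem_nhds hδ'))).exists
  refine ⟨m, g m, h1 m, h2 m, ?_, fun x => ?_⟩
  · filter_upwards [eventually_lt_of_limsup_lt hm3] with n hn hmn x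
    have h5 := (le_iSup (fun x : S.V n => S.resG n x.1 (g m (S.toTot n x)).1) x).trans hn.le
    have h6 := S.resG_eq n x (Set.inclusion (S.V_mono hmn) (g m (S.toTot n x)))
    change S.resG n x.1 (g m (S.toTot n x)).1 = _ at h6
    rw [h6] at h5
    exact (ENNReal.ofReal_le_ofReal_iff hδ.le).1 h5
  · have h5 := (le_iSup (fun x : S.Vtot => edist x (S.toTot m (g m x))) x).trans hm4.le
    rw [edist_dist] at h5
    exact (ENNReal.ofReal_le_ofReal_iff hδ.le).1 h5

/-! ### Cutoff functions -/

/-- The limsup in the non-explosion assumption supplies good cutoffs for infinitely many `n`; an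
ultrafilter concentrated on these gives one limit whose energy bound holds at all levels `m` at
once. -/
theorem exists_limit_cutoff (hG : ∀ n, (S.G n).HasCutoffs) {ε : ℝ} (hε : 0 < ε) :
    ∃ (N : ℕ) (v : W → ℝ), (∀ w, v w ∈ Icc (0 : ℝ) 1) ∧ v S.root = 1 ∧ (∀ w, w ∉ S.K N → v w = 0) ∧
      ∀ m, (S.H m).energy (fun x => v x.1) ≤ ENNReal.ofReal ε := by
  classical
  have hε' : (ENNReal.ofReal ε)⁻¹ < ⊤ := by simpa using hε
  obtain ⟨N, hN⟩ := (hS.nonexplosion.eventually (lt_mem_nhds hε')).exists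
  obtain ⟨U, hU, hfreq⟩ := exists_ultrafilter_of_frequently (frequently_lt_of_lt_limsup (h := hN))
  have key : ∀ n, ∃ f : W → ℝ, (∀ w, f w ∈ Icc (0 : ℝ) 1) ∧ (f S.root = 1) ∧
      (∀ w, w ∉ S.K N → f w = 0) ∧
      ((ENNReal.ofReal ε)⁻¹ < effRes (S.G n).energy {S.rootV n} (S.KV n N)ᶜ →
        (S.G n).energy (fun x => f x.1) ≤ ENNReal.ofReal ε) := by
    intro n
    by_cases hn : (ENNReal.ofReal ε)⁻¹ < effRes (S.G n).energy {S.rootV n} (S.KV n N)ᶜ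
    · obtain ⟨f, h1, h2, h3⟩ := exists_of_lt_effRes hn
      rw [inv_inv] at h3
      have hF : ∀ x : S.V n, Function.extend Subtype.val f 0 x.1 = f x := fun x =>
        Subtype.val_injective.extend_apply _ _ x
      refine ⟨fun w => max (min (Function.extend Subtype.val f 0 w) 1) 0,
        fun w => ⟨le_max_right _ _, max_le (min_le_right _ _) zero_le_one⟩, ?_, ?_, fun _ => ?_⟩
      · have := hF (S.rootV n)
        rw [h1 _ rfl] at this
        change max (min (Function.extend Subtype.val f 0 (S.rootV n).1) 1) 0 = 1
        rw [this]
        simp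
      · intro w hw
        have : Function.extend Subtype.val f 0 w = 0 := by
          by_cases hwV : w ∈ S.V n
          · rw [hF ⟨w, hwV⟩]
            exact h2 _ hw
          · exact Function.extend_apply' _ _ _ (fun ⟨x, hx⟩ => hwV (hx ▸ x.2))
        simp [this]
      · simp only [hF]
        exact ((S.G n).energy_clamp_le f 0 1).trans h3.le
    -- For the remaining `n` any function with the right range, root value and support will do: the
    -- ultrafilter ignores them in the energy bound.
    · exact ⟨(S.K N).indicator 1, fun w => by by_cases h : w ∈ S.K N <;> simp [h],
        by simp [S.root_mem_K N], fun w hw => by simp [hw], fun h => absurd h hn⟩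
  choose f hI hroot hK hE using key
  obtain ⟨v, hv, hlim⟩ := exists_ultralimit U f hI
  refine ⟨N, v, hv, ?_, fun w hw => ?_,
    hS.energy_le_of_tendsto hG hU hI hlim hε.le (hfreq.mono fun n hn => hE n hn)⟩
  · refine tendsto_nhds_unique (hlim _) ?_
    simp only [hroot]
    exact tendsto_const_nhds
  · refine tendsto_nhds_unique (hlim _) ?_
    simp only [hK _ w hw]
    exact tendsto_const_nhds

theorem hasCutoffs_H (hG : ∀ n, (S.G n).HasCutoffs) (m : ℕ) : (S.H m).HasCutoffs := by
  refine (S.H m).hasCutoffs_of (S.rootV m) fun ε hε => ?_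
  obtain ⟨N, v, -, hroot, hK, hE⟩ := hS.exists_limit_cutoff hG hε
  refine ⟨fun x => v x.1, (S.finite_KV m N).subset fun x hx => ?_, hroot, hE m⟩
  by_contra h
  exact hx (hK _ h)

theorem exists_le_dist (hG : ∀ n, (S.G n).HasCutoffs) {L : ℝ} (hL : 0 < L) :
    ∃ N, ∀ x : S.Vtot, x.1 ∉ S.K N → L ≤ dist S.rootTot x := by
  obtain ⟨N, v, -, hroot, hK, hE⟩ := hS.exists_limit_cutoff hG (inv_pos.2 hL)
  refine ⟨N, fun x hx => ?_⟩
  obtain ⟨m, hm⟩ := S.exists_mem x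
  have h1 := (S.H m).sq_one_sub_le (ρ := S.rootV m) (inv_pos.2 hL).le hroot (hE m) ⟨x.1, hm⟩
  have h2 : (S.H m).res (S.rootV m) ⟨x.1, hm⟩ = dist S.rootTot x :=
    (S.dist_toTot m (S.rootV m) ⟨x.1, hm⟩).symm
  rw [hK _ hx, h2] at h1
  field_simp at h1
  linarith

/-- The recovery sequence of the limit cutoff vanishes off `K N` only on `V m`. A point of `V n` off
`K N` is near a point of `V m` off `K N`, so the function is at most `1 / 2` there, and `max (2 F -
1) 0` removes the remainder. This upgrades cutoffs along a subsequence to cutoffs for all large `n`.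
-/
theorem eventually_exists_cutoff (hG : ∀ n, (S.G n).HasCutoffs) {ε : ℝ} (hε : 0 < ε) :
    ∃ N, ∀ᶠ n in atTop, ∃ f : S.V n → ℝ, f (S.rootV n) = 1 ∧ (∀ x, x.1 ∉ S.K N → f x = 0) ∧
      (S.G n).energy f ≤ ENNReal.ofReal ε := by
  obtain ⟨N, v, -, hroot, hK, hE⟩ := hS.exists_limit_cutoff hG (by positivity : 0 < ε / 8)
  obtain ⟨m, g, -, hg, hgn, -⟩ := hS.exists_neighbourhood_map (inv_pos.2 hε)
  obtain ⟨F, hF, hlim⟩ := hS.exists_recovery hG (hS.hasCutoffs_H hG m) N v (fun w _ => hK w)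
  have hlt : (S.H m).energy (fun x => v x.1) < ENNReal.ofReal (ε / 4) :=
    (hE m).trans_lt ((ENNReal.ofReal_lt_ofReal_iff (by positivity)).2 (by linarith))
  refine ⟨N, ?_⟩
  filter_upwards [eventually_ge_atTop m, hgn, hlim.eventually_lt_const hlt] with n hmn hgn hEn
  set u : (S.G n).dom := ⟨fun x => F n x.1, hEn.trans ENNReal.ofReal_lt_top⟩ with hu
  have hbil : (S.G n).bil u u ≤ ε / 4 := by
    rw [← (S.G n).toReal_energy_coe]
    exact ENNReal.toReal_le_of_le_ofReal (by positivity) hEn.le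
  refine ⟨fun x => max (2 * F n x.1 - 1) 0, ?_, fun x hx => ?_, ?_⟩
  · change max (2 * F n S.root - 1) 0 = 1
    rw [hF n hmn _ (S.root_mem_V m), hroot]
    norm_num
  · apply max_eq_right
    have h1 := (S.G n).sq_sub_le u x (Set.inclusion (S.V_mono hmn) (g (S.toTot n x)))
    have h2 : u.1 (Set.inclusion (S.V_mono hmn) (g (S.toTot n x))) = 0 := by
      change F n (g (S.toTot n x)).1 = 0
      rw [hF n hmn _ (g (S.toTot n x)).2]
      exact hK _ (hg N _ hx)
    rw [h2, sub_zero] at h1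
    have h3 : (F n x.1) ^ 2 ≤ ε⁻¹ * (ε / 4) :=
      h1.trans (mul_le_mul (hgn hmn x) hbil ((S.G n).bil_self_nonneg u) (inv_pos.2 hε).le)
    -- Distance at most `ε⁻¹` and energy at most `ε / 4` give exactly the bound `1 / 2`; doubling
    -- then brings the energy back to at most `ε`.
    have h4 : ε⁻¹ * (ε / 4) = (1 / 2) ^ 2 := by field_simp; norm_num
    rw [h4] at h3
    linarith [(abs_le_of_sq_le_sq' h3 (by norm_num)).2]
  · have h1 : (S.G n).energy (fun x => max (2 * F n x.1 - 1) 0) ≤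
        (S.G n).energy ((2 : ℝ) • u : (S.G n).dom) := by
      refine (S.G n).energy_lipschitz_le fun x y => ?_
      refine (abs_max_sub_max_le_abs _ _ _).trans (le_of_eq ?_)
      congr 1
      simp [hu]
    refine h1.trans ?_
    rw [(S.G n).energy_coe]
    apply ENNReal.ofReal_le_ofReal
    rw [map_smul, map_smul, LinearMap.smul_apply, smul_eq_mul, smul_eq_mul]
    linarith

theorem eventually_le_res (hG : ∀ n, (S.G n).HasCutoffs) {L : ℝ} (hL : 0 < L) :
    ∃ N, ∀ᶠ n in atTop, ∀ x : S.V n, x.1 ∉ S.K N → L ≤ (S.G n).res (S.rootV n) x := by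
  obtain ⟨N, hN⟩ := hS.eventually_exists_cutoff hG (inv_pos.2 hL)
  refine ⟨N, hN.mono fun n ⟨f, hroot, hK, hE⟩ x hx => ?_⟩
  have h1 := (S.G n).sq_one_sub_le (inv_pos.2 hL).le hroot hE x
  rw [hK _ hx] at h1
  field_simp at h1
  linarith

/-! ### Convergence of resistances -/

/-- Recovery of a finitely supported near-minimiser for `R(x,y)` gives test functions on `G n` of
almost the same energy. -/
theorem eventually_lt_res (hG : ∀ n, (S.G n).HasCutoffs) {m : ℕ} {x y : S.V m} (hxy : x ≠ y)
    {r : ℝ} (hr : r < (S.H m).res x y) :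
    ∀ᶠ n in atTop, ∀ h : m ≤ n,
      r < (S.G n).res (Set.inclusion (S.V_mono h) x) (Set.inclusion (S.V_mono h) y) := by
  have hpos := (S.H m).res_pos hxy
  obtain ⟨s, hs, hsR⟩ := exists_between (max_lt hr hpos)
  have hs0 : 0 < s := (le_max_right _ _).trans_lt hs
  obtain ⟨u, hux, huy, huI, hu⟩ := (S.H m).exists_unit_potential hxy
  have huu : (S.H m).bil u u < s⁻¹ := by
    rw [hu, hux, huy, sub_zero, mul_one]
    exact inv_strictAnti₀ hs0 hsR
  obtain ⟨g, hgfin, hgx, hg0, hgE⟩ :=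
    (hS.hasCutoffs_H hG m).exists_finite_support u huI x huu
  obtain ⟨N, hN⟩ := S.exists_subset_K m hgfin.toFinset
  have hext : ∀ z : S.V m, Function.extend Subtype.val g 0 z.1 = g z := fun z =>
    Subtype.val_injective.extend_apply _ _ z
  obtain ⟨F, hF, hlim⟩ := hS.exists_recovery hG (hS.hasCutoffs_H hG m) N
    (Function.extend Subtype.val g 0) (fun w hw hwK => by
      rw [hext ⟨w, hw⟩]
      by_contra h
      exact hwK (hN ⟨w, hw⟩ (hgfin.mem_toFinset.2 h)))
  simp only [hext] at hlim
  filter_upwards [hlim.eventually_lt_const hgE] with n hn hmn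
  have h1 := (S.G n).sq_le_res_mul (hn.trans ENNReal.ofReal_lt_top)
    (Set.inclusion (S.V_mono hmn) x) (Set.inclusion (S.V_mono hmn) y)
  simp only [hF n hmn _ x.2, hF n hmn _ y.2, hext, hgx, hux, hg0 y huy] at h1
  have h2 : ((S.G n).energy fun x => F n x.1).toReal ≤ s⁻¹ :=
    ENNReal.toReal_le_of_le_ofReal (inv_pos.2 hs0).le hn.le
  have h3 := h1.trans (mul_le_mul_of_nonneg_left h2 ((S.G n).res_nonneg _ _))
  have h4 : s ≤ (S.G n).res (Set.inclusion (S.V_mono hmn) x) (Set.inclusion (S.V_mono hmn) y) := by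
    rw [← div_eq_mul_inv, le_div_iff₀ hs0] at h3
    linarith
  exact ((le_max_left _ _).trans_lt hs).trans_le h4

/-- If `R_n(x,y) ≥ r` infinitely often, the unit potentials have energy at most `1 / r`, and so does
their ultralimit on `H m`, which still separates `x` and `y` by 1; hence `R(x,y) ≥ r`. -/
theorem eventually_res_lt (hG : ∀ n, (S.G n).HasCutoffs) {m : ℕ} {x y : S.V m} (hxy : x ≠ y)
    {r : ℝ} (hr : (S.H m).res x y < r) :
    ∀ᶠ n in atTop, ∀ h : m ≤ n,
      (S.G n).res (Set.inclusion (S.V_mono h) x) (Set.inclusion (S.V_mono h) y) < r := by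
  have hr0 : 0 < r := ((S.H m).res_nonneg x y).trans_lt hr
  by_contra hcon
  obtain ⟨U, hU, hfreq⟩ := exists_ultrafilter_of_frequently (not_eventually.1 hcon)
  have key : ∀ n, ∃ f : W → ℝ, (∀ w, f w ∈ Icc (0 : ℝ) 1) ∧
      ((¬ ∀ h : m ≤ n, (S.G n).res (Set.inclusion (S.V_mono h) x)
          (Set.inclusion (S.V_mono h) y) < r) →
        f x.1 = 1 ∧ f y.1 = 0 ∧ (S.G n).energy (fun z => f z.1) ≤ ENNReal.ofReal r⁻¹) := by
    intro n
    by_cases hn : ∀ h : m ≤ n, (S.G n).res (Set.inclusion (S.V_mono h) x)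
      (Set.inclusion (S.V_mono h) y) < r
    · exact ⟨0, fun w => by simp, fun h => absurd hn h⟩
    · push Not at hn
      obtain ⟨hmn, hn⟩ := hn
      obtain ⟨u, hux, huy, huI, hu⟩ := (S.G n).exists_unit_potential
        ((Set.inclusion_injective (S.V_mono hmn)).ne hxy)
      have hF : ∀ z : S.V n, Function.extend Subtype.val u.1 0 z.1 = u.1 z := fun z =>
        Subtype.val_injective.extend_apply _ _ z
      refine ⟨Function.extend Subtype.val u.1 0, fun w => ?_, fun _ => ⟨?_, ?_, ?_⟩⟩
      · by_cases hw : w ∈ S.V n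
        · rw [hF ⟨w, hw⟩]; exact huI _
        · rw [Function.extend_apply' _ _ _ (fun ⟨z, hz⟩ => hw (hz ▸ z.2))]
          simp
      · exact (hF (Set.inclusion (S.V_mono hmn) x)).trans hux
      · exact (hF (Set.inclusion (S.V_mono hmn) y)).trans huy
      · simp only [hF]
        rw [(S.G n).energy_coe, hu, hux, huy, sub_zero, mul_one]
        exact ENNReal.ofReal_le_ofReal (inv_anti₀ hr0 hn)
  choose f hI hf using key
  obtain ⟨v, hv, hlim⟩ := exists_ultralimit U f hI
  have hE := hS.energy_le_of_tendsto hG hU hI hlim (inv_pos.2 hr0).le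
    (hfreq.mono fun n hn => (hf n hn).2.2) m
  have hvx : v x.1 = 1 := tendsto_nhds_unique (hlim _)
    (tendsto_const_nhds.congr' (hfreq.mono fun n hn => (hf n hn).1.symm))
  have hvy : v y.1 = 0 := tendsto_nhds_unique (hlim _)
    (tendsto_const_nhds.congr' (hfreq.mono fun n hn => (hf n hn).2.1.symm))
  have h1 := (S.H m).sq_one_sub_le (ρ := x) (inv_pos.2 hr0).le hvx hE y
  rw [hvy] at h1
  field_simp at h1
  linarith

theorem eventually_abs_res_sub_lt (hG : ∀ n, (S.G n).HasCutoffs) (m : ℕ) (x y : S.V m) {ε : ℝ}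
    (hε : 0 < ε) :
    ∀ᶠ n in atTop, ∀ h : m ≤ n,
      |(S.G n).res (Set.inclusion (S.V_mono h) x) (Set.inclusion (S.V_mono h) y) -
        (S.H m).res x y| < ε := by
  rcases eq_or_ne x y with rfl | hxy
  · refine Eventually.of_forall fun n h => ?_
    simpa [ElectricalNetwork.res_self] using hε
  · filter_upwards [hS.eventually_lt_res hG hxy (sub_lt_self _ hε),
      hS.eventually_res_lt hG hxy (lt_add_of_pos_right _ hε)] with n h1 h2 h
    rw [abs_lt]
    constructor <;> linarith [h1 h, h2 h]

/-- The neighbourhood map sends `K N` into a finite set, within distance 1, and on that set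
resistances to the root converge. -/
theorem eventually_res_le (hG : ∀ n, (S.G n).HasCutoffs) (N : ℕ) :
    ∃ C : ℝ, ∀ᶠ n in atTop, ∀ x : S.V n, x.1 ∈ S.K N → (S.G n).res (S.rootV n) x ≤ C := by
  obtain ⟨m, g, hgK, -, hgn, -⟩ := hS.exists_neighbourhood_map one_pos
  obtain ⟨C, hC⟩ := ((S.finite_KV m N).image fun z => (S.H m).res (S.rootV m) z).bddAbove
  refine ⟨C + 2, ?_⟩
  have hfin : ∀ᶠ n in atTop, ∀ z ∈ S.KV m N, ∀ h : m ≤ n,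
      |(S.G n).res (Set.inclusion (S.V_mono h) (S.rootV m)) (Set.inclusion (S.V_mono h) z) -
        (S.H m).res (S.rootV m) z| < 1 :=
    (eventually_all_finite (S.finite_KV m N)).2 fun z _ =>
      hS.eventually_abs_res_sub_lt hG m _ z one_pos
  filter_upwards [eventually_ge_atTop m, hgn, hfin] with n hmn h1 h2 x hx
  have hz := hgK N (S.toTot n x) hx
  have h3 := abs_lt.1 (h2 _ hz hmn)
  have h4 := hC (mem_image_of_mem _ hz)
  have h5 := (S.G n).res_triangle (S.rootV n)
    (Set.inclusion (S.V_mono hmn) (g (S.toTot n x))) x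
  have h6 := h1 hmn x
  rw [(S.G n).res_comm] at h6
  have h7 := h3.2
  change (S.G n).res (S.rootV n) _ - _ < 1 at h7
  linarith

end Approximation

end ApproxSetting

/-! ### Elementary bounds used for the limit form -/

namespace ElectricalNetwork

variable {V : Type u} (G : ElectricalNetwork V)

theorem energy_smul (a : ℝ) (f : V → ℝ) : G.energy (a • f) = ENNReal.ofReal (a ^ 2) * G.energy f := by
  simp only [energy_eq_tsum, ← ENNReal.tsum_mul_left]
  refine tsum_congr fun p => ?_
  rw [mul_left_comm, ← ENNReal.ofReal_mul (sq_nonneg a)]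
  congr 2
  simp only [edgeTerm, Pi.smul_apply, smul_eq_mul]
  ring

theorem energy_add_le (f g : V → ℝ) : G.energy (f + g) ≤ 2 * (G.energy f + G.energy g) := by
  have h2 : (2 : ℝ≥0∞) = ENNReal.ofReal 2 := by simp
  simp only [energy_eq_tsum, ← ENNReal.tsum_add, ← ENNReal.tsum_mul_left]
  refine ENNReal.tsum_le_tsum fun p => ?_
  rw [← mul_add, mul_left_comm, ← ENNReal.ofReal_add (G.edgeTerm_self_nonneg _ _)
    (G.edgeTerm_self_nonneg _ _), h2, ← ENNReal.ofReal_mul (by norm_num)]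
  refine mul_le_mul_right (ENNReal.ofReal_le_ofReal ?_) _
  simp only [edgeTerm, Pi.add_apply]
  nlinarith [mul_nonneg (NNReal.coe_nonneg (G.cond p.1 p.2))
    (sq_nonneg ((f p.1 - f p.2) - (g p.1 - g p.2)))]

end ElectricalNetwork

theorem uniformContinuous_of_sq_sub_le {X : Type*} [PseudoMetricSpace X] {f : X → ℝ} {C : ℝ}
    (h : ∀ x y, (f x - f y) ^ 2 ≤ dist x y * C) : UniformContinuous f := by
  rw [Metric.uniformContinuous_iff]
  intro ε hε
  refine ⟨ε ^ 2 / (|C| + 1), by positivity, fun {x y} hxy => ?_⟩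
  rw [Real.dist_eq]
  refine abs_lt_of_sq_lt_sq ((h x y).trans_lt ?_) hε.le
  rw [lt_div_iff₀ (by positivity)] at hxy
  nlinarith [mul_le_mul_of_nonneg_left (le_abs_self C) (dist_nonneg (x := x) (y := y)),
    dist_nonneg (x := x) (y := y)]

namespace ApproxSetting

variable {W : Type u} (S : ApproxSetting W)

/-! ### The limit form -/

/-- A point of `V m` as a point of the completion. -/
noncomputable def toF (m : ℕ) (x : S.V m) : S.F := ((S.toTot m x : S.Vtot) : S.F)

theorem dist_toF (m : ℕ) (x y : S.V m) : dist (S.toF m x) (S.toF m y) = (S.H m).res x y := by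
  rw [toF, toF, UniformSpace.Completion.dist_eq, dist_toTot]

theorem exists_toF₂ (k : ℕ) (x y : S.Vtot) :
    ∃ n ≥ k, ∃ a b : S.V n, S.toF n a = x ∧ S.toF n b = y := by
  obtain ⟨m₁, h₁⟩ := S.exists_toTot x
  obtain ⟨m₂, h₂⟩ := S.exists_toTot y
  set n := max k (max m₁ m₂)
  obtain ⟨a, ha⟩ := h₁ n ((le_max_left _ _).trans (le_max_right _ _))
  obtain ⟨b, hb⟩ := h₂ n ((le_max_right _ _).trans (le_max_right _ _))
  exact ⟨n, le_max_left _ _, a, b, by rw [toF, ha], by rw [toF, hb]⟩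

/-- The energy of the restriction of `f` to `V m`. -/
noncomputable def energyAt (m : ℕ) (f : S.F → ℝ) : ℝ≥0∞ := (S.H m).energy fun x => f (S.toF m x)

theorem energyAt_mono (f : S.F → ℝ) : Monotone fun m => S.energyAt m f := fun m n h =>
  (S.H m).energy_comp_le_of_res_eq (S.H n) (Set.inclusion (S.V_mono h)) (S.compatible m n h)
    fun x => f (S.toF n x)

theorem energyAt_le_of_tendsto {m : ℕ} {ι : Type*} {l : Filter ι} [l.NeBot] {F : ι → S.F → ℝ}
    {f : S.F → ℝ} {C : ℝ≥0∞} (h : ∀ x, Tendsto (fun i => F i x) l (𝓝 (f x)))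
    (hC : ∀ᶠ i in l, S.energyAt m (F i) ≤ C) : S.energyAt m f ≤ C :=
  (S.H m).energy_le_of_tendsto (fun x => h (S.toF m x)) hC

/-- The limit of the energies of the restrictions of `f`. -/
noncomputable def limEnergy (f : S.F → ℝ) : ℝ≥0∞ := ⨆ m, S.energyAt m f

theorem energyAt_le (m : ℕ) (f : S.F → ℝ) : S.energyAt m f ≤ S.limEnergy f :=
  le_iSup (fun m => S.energyAt m f) m

theorem limEnergy_clamp_le (f : S.F → ℝ) :
    S.limEnergy (fun x => max (min (f x) 1) 0) ≤ S.limEnergy f :=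
  iSup_mono fun _ => ElectricalNetwork.energy_clamp_le _ _ _ _

theorem limEnergy_const (a : ℝ) : S.limEnergy (fun _ => a) = 0 := by
  simp [limEnergy, energyAt, ElectricalNetwork.energy_const]

/-- The domain of the limit form. -/
noncomputable def limDom : Submodule ℝ (S.F → ℝ) where
  carrier := {f | Continuous f ∧ S.limEnergy f < ⊤}
  zero_mem' := by
    refine ⟨continuous_const, ?_⟩
    change S.limEnergy (fun _ => 0) < ⊤
    rw [limEnergy_const]
    exact ENNReal.zero_lt_top
  add_mem' := by
    rintro f g ⟨hf, hfE⟩ ⟨hg, hgE⟩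
    refine ⟨hf.add hg, lt_of_le_of_lt (b := 2 * (S.limEnergy f + S.limEnergy g)) ?_
      (ENNReal.mul_lt_top (by simp) (ENNReal.add_lt_top.2 ⟨hfE, hgE⟩))⟩
    refine iSup_le fun m => ((S.H m).energy_add_le _ _).trans ?_
    exact mul_le_mul_right (add_le_add (S.energyAt_le m f) (S.energyAt_le m g)) _
  smul_mem' := by
    rintro a f ⟨hf, hfE⟩
    refine ⟨hf.const_smul a, lt_of_le_of_lt (b := ENNReal.ofReal (a ^ 2) * S.limEnergy f) ?_
      (ENNReal.mul_lt_top ENNReal.ofReal_lt_top hfE)⟩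
    refine iSup_le fun m => ((S.H m).energy_smul a _).trans_le ?_
    exact mul_le_mul_right (S.energyAt_le m f) _

/-- Restriction to `V m`. -/
noncomputable def restr (m : ℕ) : S.limDom →ₗ[ℝ] (S.H m).dom where
  toFun f := ⟨fun x => f.1 (S.toF m x), (S.energyAt_le m f.1).trans_lt f.2.2⟩
  map_add' _ _ := rfl
  map_smul' _ _ := rfl

theorem tendsto_bil_restr_self (f : S.limDom) :
    Tendsto (fun m => (S.H m).bil (S.restr m f) (S.restr m f)) atTop
      (𝓝 (S.limEnergy f).toReal) := by
  have h := (ENNReal.tendsto_toReal f.2.2.ne).comp (tendsto_atTop_iSup (S.energyAt_mono f.1))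
  refine h.congr fun m => ?_
  exact (S.H m).toReal_energy_coe (S.restr m f)

/-- The limit form, as a function of two arguments. -/
noncomputable def limFormFun (f g : S.limDom) : ℝ :=
  ((S.limEnergy (f + g : S.limDom)).toReal - (S.limEnergy (f - g : S.limDom)).toReal) / 4

/-- Polarisation at each level `m`; bilinearity and symmetry of the limit are then inherited from
the levels. -/
theorem tendsto_bil_restr (f g : S.limDom) :
    Tendsto (fun m => (S.H m).bil (S.restr m f) (S.restr m g)) atTop (𝓝 (S.limFormFun f g)) := by
  refine (((S.tendsto_bil_restr_self (f + g)).sub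
    (S.tendsto_bil_restr_self (f - g))).div_const 4).congr fun m => ?_
  simp only [map_add, map_sub, LinearMap.add_apply, LinearMap.sub_apply,
    (S.H m).bil_comm (S.restr m g) (S.restr m f)]
  ring

/-- The limit form. -/
noncomputable def limForm : S.limDom →ₗ[ℝ] S.limDom →ₗ[ℝ] ℝ :=
  LinearMap.mk₂ ℝ S.limFormFun
    (fun f g h => tendsto_nhds_unique (S.tendsto_bil_restr (f + g) h)
      (((S.tendsto_bil_restr f h).add (S.tendsto_bil_restr g h)).congr fun m => by simp))
    (fun a f g => tendsto_nhds_unique (S.tendsto_bil_restr (a • f) g)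
      (((S.tendsto_bil_restr f g).const_mul a).congr fun m => by simp))
    (fun f g h => tendsto_nhds_unique (S.tendsto_bil_restr f (g + h))
      (((S.tendsto_bil_restr f g).add (S.tendsto_bil_restr f h)).congr fun m => by simp))
    (fun a f g => tendsto_nhds_unique (S.tendsto_bil_restr f (a • g))
      (((S.tendsto_bil_restr f g).const_mul a).congr fun m => by simp))

theorem limForm_comm (f g : S.limDom) : S.limForm f g = S.limForm g f :=
  tendsto_nhds_unique (S.tendsto_bil_restr f g)
    ((S.tendsto_bil_restr g f).congr fun m => (S.H m).bil_comm _ _)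

theorem limForm_self (f : S.limDom) : S.limForm f f = (S.limEnergy f).toReal :=
  tendsto_nhds_unique (S.tendsto_bil_restr f f) (S.tendsto_bil_restr_self f)

theorem limEnergy_coe (f : S.limDom) : S.limEnergy f = ENNReal.ofReal (S.limForm f f) := by
  rw [limForm_self, ENNReal.ofReal_toReal f.2.2.ne]

theorem limForm_self_nonneg (f : S.limDom) : 0 ≤ S.limForm f f := by
  rw [limForm_self]
  exact ENNReal.toReal_nonneg

theorem formEnergy_of_mem {f : S.F → ℝ} (hf : f ∈ S.limDom) :
    formEnergy S.limDom S.limForm f = S.limEnergy f := by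
  rw [formEnergy, dif_pos hf, ← limEnergy_coe]

theorem mem_limDom_of_formEnergy_lt {f : S.F → ℝ} (hf : formEnergy S.limDom S.limForm f < ⊤) :
    f ∈ S.limDom := by
  by_contra h
  rw [formEnergy, dif_neg h] at hf
  exact lt_irrefl _ hf

theorem sq_sub_le_limForm (f : S.limDom) (x y : S.F) :
    (f.1 x - f.1 y) ^ 2 ≤ dist x y * S.limForm f f := by
  have hc := f.2.1
  induction x, y using UniformSpace.Completion.induction_on₂ with
  | hp => exact isClosed_le (by fun_prop) (by fun_prop)
  | ih x y =>
    obtain ⟨n, -, a, b, ha, hb⟩ := S.exists_toF₂ 0 x y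
    rw [← ha, ← hb, dist_toF]
    refine ((S.H n).sq_sub_le (S.restr n f) a b).trans
      (mul_le_mul_of_nonneg_left ?_ ((S.H n).res_nonneg _ _))
    rw [limForm_self, ← (S.H n).toReal_energy_coe]
    exact ENNReal.toReal_mono f.2.2.ne (S.energyAt_le n f.1)

/-- The potential of a unit current from `x` to `y` on the completion. -/
noncomputable def potF (x y z : S.F) : ℝ := (dist z y - dist z x) / 2

/-- For `x` and `y` in some `V n` the restriction is the potential of `H n`, of energy exactly the
distance. Other points follow by density, since the epigraph of a lower semicontinuous function is
closed. -/
theorem limEnergy_potF_le (x y : S.F) : S.limEnergy (S.potF x y) ≤ ENNReal.ofReal (dist x y) := by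
  refine iSup_le fun m => ?_
  induction x, y using UniformSpace.Completion.induction_on₂ with
  | hp =>
    have hc : Continuous fun p : S.F × S.F =>
        ((fun z : S.V m => S.potF p.1 p.2 (S.toF m z)), ENNReal.ofReal (dist p.1 p.2)) := by
      refine (continuous_pi fun z => ?_).prodMk (ENNReal.continuous_ofReal.comp (by fun_prop))
      unfold potF
      fun_prop
    exact (S.H m).lowerSemicontinuous_energy.isClosed_epigraph.preimage hc
  | ih x y =>
    obtain ⟨n, hmn, a, b, ha, hb⟩ := S.exists_toF₂ m x y
    refine (S.energyAt_mono _ hmn).trans (le_of_eq ?_)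
    rw [← ha, ← hb, dist_toF, ← (S.H n).energy_pot]
    change (S.H n).energy _ = _
    congr 1
    funext z
    rw [potF, dist_toF, dist_toF, ElectricalNetwork.pot]

theorem potF_mem_limDom (x y : S.F) : S.potF x y ∈ S.limDom := by
  refine ⟨?_, (S.limEnergy_potF_le x y).trans_lt ENNReal.ofReal_lt_top⟩
  unfold potF
  fun_prop

theorem potF_sub (x y : S.F) : S.potF x y x - S.potF x y y = dist x y := by
  simp only [potF, dist_self, dist_comm y x]
  ring

theorem resSup_limForm_le (x y : S.F) :
    resSup (formEnergy S.limDom S.limForm) x y ≤ ENNReal.ofReal (dist x y) := by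
  refine iSup_le fun f => iSup_le fun _ => iSup_le fun hf => ENNReal.div_le_of_le_mul ?_
  have hmem := S.mem_limDom_of_formEnergy_lt hf
  rw [S.formEnergy_of_mem hmem, S.limEnergy_coe ⟨f, hmem⟩, ← ENNReal.ofReal_mul dist_nonneg, sq_abs]
  exact ENNReal.ofReal_le_ofReal (S.sq_sub_le_limForm ⟨f, hmem⟩ x y)

theorem le_resSup_limForm (x y : S.F) :
    ENNReal.ofReal (dist x y) ≤ resSup (formEnergy S.limDom S.limForm) x y := by
  rcases eq_or_ne x y with rfl | hxy
  · simp
  have hmem := S.potF_mem_limDom x y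
  have hd : 0 < dist x y := dist_pos.2 hxy
  have h1 := S.sq_sub_le_limForm ⟨_, hmem⟩ x y
  rw [potF_sub, sq] at h1
  have h2 := le_of_mul_le_mul_left h1 hd
  have h3 : 0 < formEnergy S.limDom S.limForm (S.potF x y) := by
    rw [S.formEnergy_of_mem hmem, S.limEnergy_coe ⟨_, hmem⟩]
    exact ENNReal.ofReal_pos.2 (hd.trans_le h2)
  have h4 : formEnergy S.limDom S.limForm (S.potF x y) ≤ ENNReal.ofReal (dist x y) := by
    rw [S.formEnergy_of_mem hmem]
    exact S.limEnergy_potF_le x y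
  refine le_iSup_of_le (S.potF x y) (le_iSup_of_le h3
    (le_iSup_of_le (h4.trans_lt ENNReal.ofReal_lt_top) ?_))
  rw [potF_sub, sq_abs, ENNReal.le_div_iff_mul_le (Or.inl h3.ne')
    (Or.inl (h4.trans_lt ENNReal.ofReal_lt_top).ne), sq, ENNReal.ofReal_mul dist_nonneg]
  exact mul_le_mul_right h4 _

/-- Normalised at the root, a Cauchy sequence in energy converges pointwise, and lower
semicontinuity bounds the energy of the difference. Continuity of the limit comes from the Hölder
bound on `f k - g`. -/
theorem limForm_complete (f : ℕ → S.limDom)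
    (hf : ∀ ε > 0, ∃ k, ∀ i ≥ k, ∀ j ≥ k, S.limForm (f i - f j) (f i - f j) < ε) :
    ∃ g : S.limDom, Tendsto (fun i => S.limForm (f i - g) (f i - g)) atTop (𝓝 0) := by
  set o : S.F := S.rootF
  have hC : ∀ x, CauchySeq fun i => (f i).1 x - (f i).1 o := by
    intro x
    rw [Metric.cauchySeq_iff]
    intro ε hε
    obtain ⟨k, hk⟩ := hf (ε ^ 2 / (dist x o + 1)) (by positivity)
    refine ⟨k, fun i hi j hj => ?_⟩
    rw [Real.dist_eq]
    refine abs_lt_of_sq_lt_sq ?_ hε.le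
    have h1 := S.sq_sub_le_limForm (f i - f j) x o
    have h2 := hk i hi j hj
    rw [lt_div_iff₀ (by positivity)] at h2
    have h3 : (f i).1 x - (f i).1 o - ((f j).1 x - (f j).1 o) =
        (f i - f j : S.limDom).1 x - (f i - f j : S.limDom).1 o := by
      simp only [Submodule.coe_sub, Pi.sub_apply]
      ring
    rw [h3]
    nlinarith [S.limForm_self_nonneg (f i - f j)]
  choose g hg using fun x => cauchySeq_tendsto_of_complete (hC x)
  have hlim : ∀ i x, Tendsto (fun j => (f i).1 x - ((f j).1 x - (f j).1 o)) atTop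
      (𝓝 ((f i).1 x - g x)) := fun i x => (hg x).const_sub _
  have hE : ∀ {ε : ℝ} {k : ℕ}, (∀ i ≥ k, ∀ j ≥ k, S.limForm (f i - f j) (f i - f j) < ε) →
      ∀ i ≥ k, S.limEnergy (fun x => (f i).1 x - g x) ≤ ENNReal.ofReal ε := by
    intro ε k hk i hi
    refine iSup_le fun m => S.energyAt_le_of_tendsto (hlim i) ?_
    filter_upwards [eventually_ge_atTop k] with j hj
    have h1 : S.energyAt m (fun x => (f i).1 x - ((f j).1 x - (f j).1 o)) =
        S.energyAt m (f i - f j : S.limDom) := by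
      rw [energyAt, ← (S.H m).energy_sub_const _ ((f j).1 o)]
      congr 1
      funext x
      simp only [Submodule.coe_sub, Pi.sub_apply]
      ring
    rw [h1]
    refine (S.energyAt_le m _).trans ?_
    rw [limEnergy_coe]
    exact ENNReal.ofReal_le_ofReal (hk i hi j hj).le
  obtain ⟨k, hk⟩ := hf 1 one_pos
  have hcont : Continuous fun x => (f k).1 x - g x := by
    refine (uniformContinuous_of_sq_sub_le (C := 1) fun x y => ?_).continuous
    refine le_of_tendsto (((hlim k x).sub (hlim k y)).pow 2) ?_
    filter_upwards [eventually_ge_atTop k] with j hj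
    have h1 := S.sq_sub_le_limForm (f k - f j) x y
    have h2 := mul_le_mul_of_nonneg_left (hk k le_rfl j hj).le (dist_nonneg (x := x) (y := y))
    refine le_trans (le_of_eq ?_) (h1.trans h2)
    simp only [Submodule.coe_sub, Pi.sub_apply]
    ring
  have hmem : (fun x => (f k).1 x - g x) ∈ S.limDom :=
    ⟨hcont, (hE hk k le_rfl).trans_lt ENNReal.ofReal_lt_top⟩
  have hgmem : g ∈ S.limDom := by
    have h1 := S.limDom.sub_mem (f k).2 hmem
    have h2 : (f k).1 - (fun x => (f k).1 x - g x) = g := by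
      funext x
      simp
    rwa [h2] at h1
  refine ⟨⟨g, hgmem⟩, Metric.tendsto_atTop.2 fun ε hε => ?_⟩
  obtain ⟨k, hk⟩ := hf (ε / 2) (half_pos hε)
  refine ⟨k, fun i hi => ?_⟩
  rw [Real.dist_0_eq_abs, abs_of_nonneg (S.limForm_self_nonneg _), limForm_self]
  refine lt_of_le_of_lt (ENNReal.toReal_le_of_le_ofReal (half_pos hε).le (hE hk i hi)) ?_
  linarith

/-- The resistance form on the completion whose resistance metric is the metric of the
completion. -/
noncomputable def limResistanceForm : ResistanceForm S.F where
  domain := S.limDom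
  form := S.limForm
  const_mem a := ⟨continuous_const, by rw [limEnergy_const]; exact ENNReal.zero_lt_top⟩
  symm := S.limForm_comm
  nonneg := S.limForm_self_nonneg
  eq_zero_iff f := by
    constructor
    · intro h
      refine ⟨f.1 S.rootF, fun x => ?_⟩
      have h1 := S.sq_sub_le_limForm f x S.rootF
      rw [h, mul_zero] at h1
      exact sub_eq_zero.1 (pow_eq_zero_iff two_ne_zero |>.1 (le_antisymm h1 (sq_nonneg _)))
    · rintro ⟨a, ha⟩
      rw [limForm_self, show f.1 = fun _ => a from funext ha, limEnergy_const, ENNReal.toReal_zero]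
  complete := S.limForm_complete
  separates x y hxy := by
    refine ⟨S.potF x y, S.potF_mem_limDom x y, fun h => ?_⟩
    have h1 := S.potF_sub x y
    rw [h, sub_self] at h1
    exact hxy (dist_eq_zero.1 h1.symm)
  resistance_lt_top x y := (S.resSup_limForm_le x y).trans_lt ENNReal.ofReal_lt_top
  markov f := by
    have h1 := S.limEnergy_clamp_le f.1
    have hmem : (fun x => max (min (f.1 x) 1) 0) ∈ S.limDom :=
      ⟨(f.2.1.min continuous_const).max continuous_const, h1.trans_lt f.2.2⟩
    refine ⟨hmem, ?_⟩
    rw [limForm_self, limForm_self]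
    exact ENNReal.toReal_mono f.2.2.ne h1

theorem res_limResistanceForm (x y : S.F) : S.limResistanceForm.res x y = dist x y := by
  have h : resSup S.limResistanceForm.energy x y = ENNReal.ofReal (dist x y) :=
    le_antisymm (S.resSup_limForm_le x y) (S.le_resSup_limForm x y)
  rw [ResistanceForm.res, h, ENNReal.toReal_ofReal dist_nonneg]

end ApproxSetting

namespace ApproxSetting

variable {W : Type u} {S : ApproxSetting W}

namespace Approximation

variable (hS : S.Approximation)
include hS

/-! ### The limit space -/

theorem exists_dist_le (N : ℕ) : ∃ C : ℝ, ∀ x : S.Vtot, x.1 ∈ S.K N → dist S.rootTot x ≤ C := by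
  obtain ⟨m, g, hgK, -, -, hgd⟩ := hS.exists_neighbourhood_map one_pos
  obtain ⟨C, hC⟩ := ((S.finite_KV m N).image fun z => dist S.rootTot (S.toTot m z)).bddAbove
  refine ⟨C + 1, fun x hx => ?_⟩
  have h1 := hC (mem_image_of_mem _ (hgK N x hx))
  have h2 := dist_triangle_right S.rootTot x (S.toTot m (g x))
  have h3 := hgd x
  linarith

/-- For every radius and scale, some `V m ∩ K N` approximates the balls of that radius. -/
theorem exists_approximating_KV (hG : ∀ n, (S.G n).HasCutoffs) (r : ℝ) {δ : ℝ} (hδ : 0 < δ) :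
    ∃ m N, (∀ᶠ n in atTop, ∀ (h : m ≤ n) (x : S.V n), (S.G n).res x (S.rootV n) < r →
        ∃ z ∈ S.KV m N, (S.G n).res x (Set.inclusion (S.V_mono h) z) ≤ δ) ∧
      ∀ y : S.F, dist y S.rootF < r → ∃ z ∈ S.KV m N, dist y (S.toF m z) ≤ δ := by
  obtain ⟨m, g, hgK, -, hgn, hgd⟩ := hS.exists_neighbourhood_map (half_pos hδ)
  -- The extra 1 leaves room to replace a point of the completion by a nearby vertex.
  have hL : 0 < |r| + 1 := by positivity
  obtain ⟨N₁, hN₁⟩ := hS.eventually_le_res hG hL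
  obtain ⟨N₂, hN₂⟩ := hS.exists_le_dist hG hL
  refine ⟨m, max N₁ N₂, ?_, fun y hy => ?_⟩
  · filter_upwards [hgn, hN₁] with n hn hn₁ hmn x hx
    have hxK : x.1 ∈ S.K N₁ := by
      by_contra h
      have h1 := hn₁ x h
      rw [(S.G n).res_comm] at h1
      linarith [le_abs_self r]
    exact ⟨g (S.toTot n x), hgK _ _ (S.K_mono (le_max_left _ _) hxK),
      (hn hmn x).trans (by linarith)⟩
  · obtain ⟨x, hx⟩ := Metric.denseRange_iff.1
      (UniformSpace.Completion.denseRange_coe (α := S.Vtot)) y (min (δ / 2) 1) (by positivity)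
    have hxo : dist S.rootTot x < |r| + 1 := by
      rw [← UniformSpace.Completion.dist_eq]
      refine (dist_triangle_left _ _ y).trans_lt ?_
      linarith [hx.trans_le (min_le_right _ _), le_abs_self r,
        show dist y ((S.rootTot : S.Vtot) : S.F) < r from hy]
    have hxK : x.1 ∈ S.K N₂ := by
      by_contra h
      exact absurd hxo (not_lt.2 (hN₂ x h))
    refine ⟨g x, hgK _ _ (S.K_mono (le_max_right _ _) hxK), ?_⟩
    refine (dist_triangle _ (x : S.F) _).trans ?_
    have h1 := hgd x
    rw [← UniformSpace.Completion.dist_eq] at h1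
    have h2 := hx.trans_le (min_le_left _ _)
    rw [toF]
    linarith

theorem properSpace_F (hG : ∀ n, (S.G n).HasCutoffs) : ProperSpace S.F := by
  refine ProperSpace.of_seq_closedBall (x := S.rootF) tendsto_id
    (Eventually.of_forall fun r => ?_)
  refine TotallyBounded.isCompact_of_isClosed (Metric.totallyBounded_iff.2 fun ε hε => ?_)
    Metric.isClosed_closedBall
  -- The radius `r + 1` puts the closed ball inside an open one.
  obtain ⟨m, N, -, h⟩ := hS.exists_approximating_KV hG (r + 1) (half_pos hε)
  refine ⟨S.toF m '' S.KV m N, (S.finite_KV m N).image _, fun y hy => ?_⟩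
  obtain ⟨z, hz, hyz⟩ := h y (lt_of_le_of_lt hy (lt_add_one _))
  exact mem_iUnion₂.2 ⟨_, mem_image_of_mem _ hz, lt_of_le_of_lt hyz (half_lt_self hε)⟩

/-- The limit cutoff is uniformly continuous by its energy bound, so it extends to the completion;
it vanishes off a bounded set because `K N` is bounded in `R`. -/
theorem isRecurrentAt_F (hG : ∀ n, (S.G n).HasCutoffs) :
    IsRecurrentAt S.limResistanceForm.energy (fun y z => dist y z) S.rootF := by
  refine ENNReal.tendsto_nhds_top_iff_nnreal.2 fun L => ?_
  have hε : (0 : ℝ) < (L + 1)⁻¹ := by positivity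
  obtain ⟨N, v, -, hroot, hK, hE⟩ := hS.exists_limit_cutoff hG hε
  obtain ⟨C, hC⟩ := hS.exists_dist_le N
  have huc : UniformContinuous fun x : S.Vtot => v x.1 := by
    refine uniformContinuous_of_sq_sub_le (C := ((L : ℝ) + 1)⁻¹) fun x y => ?_
    obtain ⟨m₁, h₁⟩ := S.exists_toTot x
    obtain ⟨m₂, h₂⟩ := S.exists_toTot y
    obtain ⟨a, rfl⟩ := h₁ (max m₁ m₂) (le_max_left _ _)
    obtain ⟨b, rfl⟩ := h₂ (max m₁ m₂) (le_max_right _ _)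
    rw [dist_toTot]
    exact ((S.H _).sq_le_res_mul ((hE _).trans_lt ENNReal.ofReal_lt_top) a b).trans
      (mul_le_mul_of_nonneg_left (ENNReal.toReal_le_of_le_ofReal hε.le (hE _))
        ((S.H _).res_nonneg _ _))
  set f : S.F → ℝ := UniformSpace.Completion.extension fun x : S.Vtot => v x.1
  have hf : ∀ x : S.Vtot, f x = v x.1 := UniformSpace.Completion.extension_coe huc
  have hfc : Continuous f := UniformSpace.Completion.continuous_extension
  have hfE : S.limEnergy f ≤ ENNReal.ofReal (L + 1)⁻¹ := by
    refine iSup_le fun m => ?_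
    have : (fun x => f (S.toF m x)) = fun x : S.V m => v x.1 := funext fun x => hf _
    rw [energyAt, this]
    exact hE m
  have hmem : f ∈ S.limDom := ⟨hfc, hfE.trans_lt ENNReal.ofReal_lt_top⟩
  filter_upwards [eventually_gt_atTop C] with r hr
  refine lt_of_lt_of_le (b := ENNReal.ofReal (L + 1)) ?_ (le_effRes f ?_ ?_ ?_)
  · rw [← ENNReal.ofReal_coe_nnreal]
    exact (ENNReal.ofReal_lt_ofReal_iff (by positivity)).2 (by linarith)
  · rintro x rfl
    exact (hf S.rootTot).trans hroot
  · intro y hy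
    -- The alternative is a closed condition, so it passes from the vertices to their completion.
    have h1 : ∀ y, dist S.rootF y ≤ C ∨ f y = 0 := by
      intro y
      induction y using UniformSpace.Completion.induction_on with
      | hp =>
        exact (isClosed_le (continuous_const.dist continuous_id) continuous_const).union
          (isClosed_eq hfc continuous_const)
      | ih x =>
        by_cases hx : x.1 ∈ S.K N
        · exact Or.inl ((UniformSpace.Completion.dist_eq _ _).trans_le (hC x hx))
        · exact Or.inr ((hf x).trans (hK _ hx))
    exact (h1 y).resolve_left fun h => hy (h.trans_lt hr)
  · change formEnergy S.limDom S.limForm f ≤ _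
    rw [S.formEnergy_of_mem hmem, ← ENNReal.ofReal_inv_of_pos (by positivity)]
    exact hfE

/-! ### Convergence of the approximating spaces -/

theorem tendsto_localGHDist (hproper : ∀ n, ProperSpace (S.G n).Space)
    (hG : ∀ n, (S.G n).HasCutoffs) :
    Tendsto (fun n => localGHDist (S.G n).Space S.F (S.rootV n) S.rootF) atTop (𝓝 0) := by
  have := hS.properSpace_F hG
  refine ENNReal.tendsto_nhds_zero.2 fun ε hε => ?_
  obtain ⟨δ, hδ, r₀, h⟩ := exists_localGHDist_le S.rootF hε
  obtain ⟨m, N, hn, hF⟩ := hS.exists_approximating_KV hG r₀ hδ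
  have hfin : ∀ᶠ n in atTop, ∀ a ∈ S.KV m N, ∀ b ∈ S.KV m N, ∀ h : m ≤ n,
      |(S.G n).res (Set.inclusion (S.V_mono h) a) (Set.inclusion (S.V_mono h) b) -
        (S.H m).res a b| < δ :=
    (eventually_all_finite (S.finite_KV m N)).2 fun a _ =>
      (eventually_all_finite (S.finite_KV m N)).2 fun b _ =>
        hS.eventually_abs_res_sub_lt hG m a b hδ
  filter_upwards [hn, hfin, eventually_ge_atTop m] with n hn hfin hmn
  refine h (S.G n).Space (S.rootV n) (S.KV m N) (fun z => Set.inclusion (S.V_mono hmn) z.1)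
    (fun z => S.toF m z.1) ⟨S.rootV m, S.root_mem_K N⟩ rfl rfl (fun a b => ?_) (fun x hx => ?_)
    (fun y hy => ?_)
  · rw [dist_toF]
    exact (hfin a.1 a.2 b.1 b.2 hmn).le
  · obtain ⟨z, hz, hxz⟩ := hn hmn x hx
    exact ⟨⟨z, hz⟩, hxz⟩
  · obtain ⟨z, hz, hyz⟩ := hF y hy
    exact ⟨⟨z, hz⟩, hyz⟩

/-- Cutoffs supported in `K N` exist for all large `n`, and `K N` then lies in a ball whose radius
does not depend on `n`. -/
theorem tendsto_liminf_effRes (hG : ∀ n, (S.G n).HasCutoffs) :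
    Tendsto (fun r : ℝ => liminf (fun n => effRes (S.G n).energy {S.rootV n}
      {x | (S.G n).res (S.rootV n) x < r}ᶜ) atTop) atTop (𝓝 ⊤) := by
  refine ENNReal.tendsto_nhds_top_iff_nnreal.2 fun L => ?_
  have hε : (0 : ℝ) < (L + 1)⁻¹ := by positivity
  obtain ⟨N, hN⟩ := hS.eventually_exists_cutoff hG hε
  obtain ⟨C, hC⟩ := hS.eventually_res_le hG N
  filter_upwards [eventually_gt_atTop C] with r hr
  refine lt_of_lt_of_le (b := ENNReal.ofReal (L + 1)) ?_ (le_liminf_of_le (h := ?_))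
  · rw [← ENNReal.ofReal_coe_nnreal]
    exact (ENNReal.ofReal_lt_ofReal_iff (by positivity)).2 (by linarith)
  · filter_upwards [hN, hC] with n ⟨f, hroot, hK, hE⟩ hCn
    refine le_effRes f (by rintro x rfl; exact hroot) (fun x hx => hK x fun hxK => hx ?_) ?_
    · exact (hCn x hxK).trans_lt hr
    · rwa [← ENNReal.ofReal_inv_of_pos (by positivity)]

end Approximation

end ApproxSetting

theorem theoremA {W : Type u} (S : ApproxSetting W)
    (hproper : ∀ n, ProperSpace (S.G n).Space)
    (hrec : ∀ n, IsRecurrentAt (S.G n).energy (S.G n).res (S.rootV n))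
    (hS : S.Approximation) :
    ProperSpace S.F ∧
    IsRecurrentResistanceMetric S.F S.rootF ∧
    Tendsto (fun n => localGHDist (S.G n).Space S.F (S.rootV n) S.rootF) atTop (𝓝 0) ∧
    Tendsto (fun r : ℝ => liminf (fun n => effRes (S.G n).energy {S.rootV n}
      {x | (S.G n).res (S.rootV n) x < r}ᶜ) atTop) atTop (𝓝 ⊤) := by
  have hG : ∀ n, (S.G n).HasCutoffs := fun n =>
    (S.G n).hasCutoffs_of_isRecurrentAt (S.rootV n) (hrec n)
  exact ⟨hS.properSpace_F hG, ⟨S.limResistanceForm, S.res_limResistanceForm,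
    hS.isRecurrentAt_F hG⟩, hS.tendsto_localGHDist hproper hG, hS.tendsto_liminf_effRes hG⟩
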